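/- All matroids have finite ground sets. For matroids $M,N$ on a common ground set $E$, $N$ is a \emph{quotient} of $M$, written $M\twoheadrightarrow N$, if every flat of $N$ is a flat of $M$; its nullity is $\operatorname{rk}(M)-\operatorname{rk}(N)$, it is \emph{elementary} if the nullity is $1$, and the nullity of $A\subseteq E$ is $n(A)=\operatorname{rk}_M(A)-\operatorname{rk}_N(A)$. If $f:M\twoheadrightarrow N$ has nullity $k$ and $0\le i\le k$, the \emph{Higgs lift} $L^i(f)$ is the matroid on $E$ whose flats are the flats of $N$ together with the flats of $M$ of nullity less than $i$; the chain of elementary quotients $M=L^k(f)\twoheadrightarrow\dots\twoheadrightarrow L^0(f)=N$ is the \emph{Higgs factorization} of $f$. A \emph{flag matroid} of length $l$ is a chain of quotients $M_1\overset{f_1}{\twoheadrightarrow}M_2\overset{f_2}{\twoheadrightarrow}\cdots\overset{f_l}{\twoheadrightarrow}M_{l+1}$. Its \emph{Higgs factorization} is the chain of elementary quotients $M_1=N_0\twoheadrightarrow N_1\twoheadrightarrow\dots\twoheadrightarrow N_k=M_{l+1}$, $k=\operatorname{rk}(M_1)-\operatorname{rk}(M_{l+1})$, obtained by concatenating the Higgs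 factorizations of $f_1,\dots,f_l$. Its \emph{Higgs major} is the matroid $H_k$ on $E\sqcup\{e_1,\dots,e_k\}$ obtained from $H_0=N_0$ as follows: for $1\le i\le k$, $H_i$ is the one-element extension of $H_{i-1}$ by $e_i$ with respect to the modular cut $\{F\cup\{e_1,\dots,e_{i-1}\}:F\in\mathcal M_i\}$, where $\mathcal M_i$ is the set of flats $F$ of $N_{i-1}$ with $\operatorname{rk}_{N_{i-1}}(F)-\operatorname{rk}_{N_i}(F)=1$, i.e. the modular cut corresponding to the elementary quotient $N_{i-1}\twoheadrightarrow N_i$. Let $K$ be a field. A matroid $M$ on $E$ is \emph{realizable} over $K$ if there are a $K$-vector space $V$ of dimension $\operatorname{rk}(M)$ and a map $\varphi:E\to V$ (which is said to realize $M$) such that $A\subseteq E$ is independent in $M$ if and only if the family $(\varphi(a))_{a\in A}$ is linearly independent. A chain of quotients $P_0\twoheadrightarrow P_1\twoheadrightarrow\dots\twoheadrightarrow P_m$ is \emph{realizable} over $K$ if there are maps $\varphi_i:E\to V_i$ realizing $P_i$ for $0\le i\le m$, and linear maps $g_i:V_i\to V_{i+1}$ with $g_i\circ\varphi_i=\varphi_{i+1}$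 for $0\le i<m$. \textbf{Theorem.} Let $M_1\twoheadrightarrow M_2\twoheadrightarrow\dots\twoheadrightarrow M_{l+1}$ be a flag matroid and let $K$ be an infinite field. The following statements are equivalent: (1) the flag matroid is realizable over $K$; (2) the Higgs factorization of the flag matroid is realizable over $K$; (3) the Higgs major of the flag matroid is realizable over $K$. -/

import Mathlib

open Set

namespace HiggsMajor

universe u v w

/-! ### Ranks -/

/-- The rank of a set in a matroid, as a natural number (the matroids below all have finite ground
sets, so this is the usual rank). -/
noncomputable def rk {α : Type v} (M : Matroid α) (A : Set α) : ℕ := (M.eRk A).toNat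

theorem coe_rk {α : Type v} (M : Matroid α) [M.Finite] (A : Set α) :
    (rk M A : ℕ∞) = M.eRk A :=
  ENat.natCast_toNat (Matroid.eRk_ne_top_iff.2 (Matroid.isRkFinite_set M A))

theorem rk_mono {α : Type v} (M : Matroid α) [M.Finite] {A B : Set α} (h : A ⊆ B) :
    rk M A ≤ rk M B := by
  have := M.eRk_mono h
  rwa [← coe_rk, ← coe_rk, Nat.cast_le] at this

theorem rk_insert_le {α : Type v} (M : Matroid α) [M.Finite] (e : α) (A : Set α) :
    rk M (insert e A) ≤ rk M A + 1 := by
  have := M.eRk_insert_le_add_one e A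
  rw [← coe_rk, ← coe_rk] at this
  exact_mod_cast this

theorem rk_submod {α : Type v} (M : Matroid α) [M.Finite] (A B : Set α) :
    rk M (A ∩ B) + rk M (A ∪ B) ≤ rk M A + rk M B := by
  have := M.eRk_inter_add_eRk_union_le A B
  simp only [← coe_rk] at this
  exact_mod_cast this

theorem rk_closure {α : Type v} (M : Matroid α) (A : Set α) : rk M (M.closure A) = rk M A := by
  simp [rk]

theorem rk_inter_ground {α : Type v} (M : Matroid α) (A : Set α) :
    rk M (A ∩ M.E) = rk M A := by
  simp [rk]

theorem mem_closure_iff_rk {α : Type v} (M : Matroid α) [M.Finite] {e : α} (he : e ∈ M.E)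
    (A : Set α) : e ∈ M.closure A ↔ rk M (insert e A) = rk M A := by
  constructor
  · intro h
    rw [← rk_closure M A, ← rk_closure M (insert e A), Matroid.closure_insert_eq_of_mem_closure h]
  · intro h
    by_contra hc
    have := M.eRk_insert_eq_add_one ⟨he, hc⟩
    rw [← coe_rk, ← coe_rk, h] at this
    have h2 : rk M A = rk M A + 1 := by exact_mod_cast this
    omega

theorem isFlat_iff_rk {α : Type v} (M : Matroid α) [M.Finite] (F : Set α) :
    M.IsFlat F ↔ F ⊆ M.E ∧ ∀ e ∈ M.E, e ∉ F → rk M (insert e F) = rk M F + 1 := by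
  constructor
  · intro h
    refine ⟨h.subset_ground, fun e he heF => ?_⟩
    have h1 := (mem_closure_iff_rk M he F).not
    rw [h.closure] at h1
    have h2 := h1.1 heF
    have h3 := rk_insert_le M e F
    have h4 := rk_mono M (subset_insert e F)
    omega
  · rintro ⟨h1, h2⟩
    rw [Matroid.isFlat_iff_closure_eq]
    refine subset_antisymm (fun e he => ?_) (M.subset_closure F h1)
    by_contra hc
    have heE := Matroid.mem_ground_of_mem_closure he
    have := (mem_closure_iff_rk M heE F).1 he
    have := h2 e heE hc
    omega

theorem eq_of_rk_eq {α : Type v} {M N : Matroid α} [M.Finite] (hE : M.E = N.E)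
    (h : ∀ A ⊆ M.E, rk M A = rk N A) : M = N := by
  have : N.Finite := ⟨hE ▸ M.ground_finite⟩
  refine Matroid.ext_indep hE fun I hI => ?_
  have hf : I.Finite := M.ground_finite.subset hI
  rw [Matroid.indep_iff_eRk_eq_encard_of_finite hf, Matroid.indep_iff_eRk_eq_encard_of_finite hf,
    ← coe_rk, ← coe_rk, h I hI]

/-! ### Matroids from rank functions -/

/-- `r` is the rank function of a matroid with ground set `E`, extended to all sets by
`r A = r (A ∩ E)`. -/
structure IsRankFunction {α : Type v} (E : Set α) (r : Set α → ℕ) : Prop where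
  empty : r ∅ = 0
  inter_ground : ∀ A, r (A ∩ E) = r A
  mono : ∀ A B, A ⊆ B → r A ≤ r B
  insert_le : ∀ e A, r (insert e A) ≤ r A + 1
  insert_insert : ∀ x y A, r (insert x A) = r A → r (insert y A) = r A →
    r (insert x (insert y A)) = r A

namespace IsRankFunction

variable {α : Type v} {E : Set α} {r : Set α → ℕ}

theorem le_ncard (hr : IsRankFunction E r) {A : Set α} (hA : A.Finite) : r A ≤ A.ncard := by
  induction A, hA using Set.Finite.induction_on with
  | empty => simp [hr.empty]
  | @insert a s ha hs ih =>
    rw [ncard_insert_of_notMem ha hs]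
    have := hr.insert_le a s
    omega

theorem union_le (hr : IsRankFunction E r) (A : Set α) {B : Set α} (hB : B.Finite) :
    r (A ∪ B) ≤ r A + B.ncard := by
  induction B, hB using Set.Finite.induction_on with
  | empty => simp
  | @insert a s ha hs ih =>
    rw [ncard_insert_of_notMem ha hs, union_insert]
    have := hr.insert_le a (A ∪ s)
    omega

theorem union_eq (hr : IsRankFunction E r) (A : Set α) {B : Set α} (hB : B.Finite)
    (h : ∀ e ∈ B, r (insert e A) = r A) : r (A ∪ B) = r A := by
  suffices H : ∀ n : ℕ, ∀ S ⊆ B, S.ncard = n → r (A ∪ S) = r A from H _ B subset_rfl rfl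
  intro n
  induction n using Nat.strong_induction_on with
  | _ n ih =>
    intro S hS hn
    have hSf := hB.subset hS
    rcases S.eq_empty_or_nonempty with rfl | ⟨x, hx⟩
    · simp
    rcases (S \ {x}).eq_empty_or_nonempty with h0 | ⟨y, hy⟩
    · have : S = {x} := subset_antisymm (sdiff_eq_empty.1 h0) (singleton_subset_iff.2 hx)
      rw [this, union_singleton]
      exact h x (hS hx)
    set T := (S \ {x}) \ {y} with hT
    have hxS : insert y T = S \ {x} := by
      rw [hT, insert_sdiff_singleton, insert_eq_of_mem hy]
    have hxS' : insert x (S \ {x}) = S := by rw [insert_sdiff_singleton, insert_eq_of_mem hx]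
    have hyx : y ≠ x := fun hh => hy.2 hh
    have hyS : insert x T = S \ {y} := by
      ext z; simp only [hT, mem_insert_iff, mem_sdiff, mem_singleton_iff]
      constructor
      · rintro (rfl | hz)
        · exact ⟨hx, hyx.symm⟩
        · exact ⟨hz.1.1, hz.2⟩
      · rintro ⟨h1, h2⟩
        by_cases hzx : z = x
        · exact Or.inl hzx
        · exact Or.inr ⟨⟨h1, hzx⟩, h2⟩
    have l1 : (S \ {x}).ncard < n := hn ▸ ncard_sdiff_singleton_lt_of_mem hx hSf
    have l2 : (S \ {y}).ncard < n := hn ▸ ncard_sdiff_singleton_lt_of_mem hy.1 hSf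
    have l3 : T.ncard < n :=
      lt_of_le_of_lt (ncard_le_ncard sdiff_subset (hSf.subset sdiff_subset)) l1
    have e1 := ih _ l1 _ (sdiff_subset.trans hS) rfl
    have e2 := ih _ l2 _ (sdiff_subset.trans hS) rfl
    have e3 := ih _ l3 T ((sdiff_subset.trans sdiff_subset).trans hS) rfl
    rw [← hxS, union_insert] at e1
    rw [← hyS, union_insert] at e2
    have := hr.insert_insert x y (A ∪ T) (by rw [e2, e3]) (by rw [e1, e3])
    rw [← union_insert, ← union_insert, hxS, hxS'] at this
    rw [this, e3]

end IsRankFunction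

/-- The matroid on the finite set `E` with rank function `r`: a set `I ⊆ E` is independent when
`r I = |I|`. -/
noncomputable def matroidOfRank {α : Type v} {E : Set α} {r : Set α → ℕ} (hE : E.Finite)
    (hr : IsRankFunction E r) : Matroid α :=
  (IndepMatroid.ofFinite hE (fun I => I ⊆ E ∧ r I = I.ncard)
    ⟨empty_subset _, by simp [hr.empty]⟩
    (fun I J hJ hIJ => by
      have hJf := hE.subset hJ.1
      have hIf := hJf.subset hIJ
      refine ⟨hIJ.trans hJ.1, le_antisymm (hr.le_ncard hIf) ?_⟩
      have h1 := hr.union_le I (hJf.subset (sdiff_subset (t := I)))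
      rw [union_sdiff_cancel hIJ, hJ.2] at h1
      have h2 := ncard_sdiff_add_ncard_of_subset hIJ hJf
      omega)
    (fun I J hI hJ hIJ => by
      by_contra! hc
      have hJf := hE.subset hJ.1
      have hIf := hE.subset hI.1
      have h1 : r (I ∪ J) = r I := by
        refine hr.union_eq I hJf fun e he => ?_
        by_cases heI : e ∈ I
        · rw [insert_eq_of_mem heI]
        have h2 := hc e he heI (insert_subset (hJ.1 he) hI.1)
        rw [ncard_insert_of_notMem heI hIf] at h2
        have h3 := hr.insert_le e I
        have h4 := hr.mono I _ (subset_insert e I)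
        have h5 := hI.2
        omega
      have h2 := hr.mono J (I ∪ J) subset_union_right
      rw [h1, hI.2, hJ.2] at h2
      omega)
    (fun I hI => hI.1)).matroid

section

variable {α : Type v} {E : Set α} {r : Set α → ℕ} (hE : E.Finite) (hr : IsRankFunction E r)

theorem matroidOfRank_ground : (matroidOfRank hE hr).E = E := rfl

instance : (matroidOfRank hE hr).Finite := ⟨hE⟩

theorem matroidOfRank_indep {I : Set α} :
    (matroidOfRank hE hr).Indep I ↔ I ⊆ E ∧ r I = I.ncard := Iff.rfl

theorem rk_matroidOfRank (A : Set α) : rk (matroidOfRank hE hr) A = r A := by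
  obtain ⟨I, hI⟩ := (matroidOfRank hE hr).exists_isBasis' A
  have hIi := (matroidOfRank_indep hE hr).1 hI.indep
  have hIf := hE.subset hIi.1
  have h1 : rk (matroidOfRank hE hr) A = I.ncard := by
    rw [rk, ← hI.encard_eq_eRk, ncard_def]
  have h2 : r (I ∪ (A ∩ E)) = r I := by
    refine hr.union_eq I (hE.subset inter_subset_right) fun e he => ?_
    by_cases heI : e ∈ I
    · rw [insert_eq_of_mem heI]
    have h3 : ¬ (matroidOfRank hE hr).Indep (insert e I) := fun hc =>
      heI (hI.mem_of_insert_indep he.1 hc)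
    rw [matroidOfRank_indep] at h3
    have h4 : ¬ r (insert e I) = (insert e I).ncard := fun hc =>
      h3 ⟨insert_subset he.2 hIi.1, hc⟩
    rw [ncard_insert_of_notMem heI hIf] at h4
    have h5 := hr.insert_le e I
    have h6 := hr.mono I _ (subset_insert e I)
    have h7 := hIi.2
    omega
  rw [union_eq_self_of_subset_left (subset_inter hI.subset hIi.1), hr.inter_ground] at h2
  rw [h1, h2, hIi.2]

end

/-! ### Morphisms and quotients -/

/-- A map of ground sets is a morphism of matroids when preimages of flats are flats. -/
def IsMorphism {α : Type v} {β : Type w} (M : Matroid α) (N : Matroid β) (f : α → β) : Prop :=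
  MapsTo f M.E N.E ∧ ∀ F, N.IsFlat F → M.IsFlat (f ⁻¹' F ∩ M.E)

/-- `N` is a quotient of `M`: they have the same ground set and the identity is a morphism. -/
def IsQuotient {α : Type v} (M N : Matroid α) : Prop :=
  M.E = N.E ∧ IsMorphism M N id

/-- The nullity `rk M A - rk N A` of a set with respect to a quotient from `M` to `N`
(it is never truncated, see `IsQuotient.rk_le`). -/
noncomputable def setNullity {α : Type v} (M N : Matroid α) (A : Set α) : ℕ := rk M A - rk N A

namespace IsQuotient

variable {α : Type v} {M N : Matroid α}

theorem ground_eq (h : IsQuotient M N) : M.E = N.E := h.1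

theorem isFlat (h : IsQuotient M N) {F : Set α} (hF : N.IsFlat F) : M.IsFlat F := by
  have h1 := h.2.2 F hF
  rwa [preimage_id, inter_eq_self_of_subset_left (h.1 ▸ hF.subset_ground)] at h1

theorem finite_right [M.Finite] (h : IsQuotient M N) : N.Finite := ⟨h.1 ▸ M.ground_finite⟩

theorem rk_insert [M.Finite] (h : IsQuotient M N) (e : α) (A : Set α) :
    rk N (insert e A) + rk M A ≤ rk M (insert e A) + rk N A := by
  have := h.finite_right
  have h1 := rk_mono M (subset_insert e A)
  have h2 := rk_insert_le N e A
  by_cases he : e ∈ N.E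
  · by_cases hc : e ∈ N.closure A
    · have := (mem_closure_iff_rk N he A).1 hc
      omega
    · have h3 : e ∉ M.closure A := by
        intro h4
        have hF : N.IsFlat (N.closure A) := N.isFlat_closure A
        have hA : A ∩ M.E ⊆ N.closure A := by
          rw [h.1, ← N.closure_inter_ground]
          exact N.subset_closure _ inter_subset_right
        rw [Matroid.closure_def] at h4
        exact hc (h4 _ ⟨h.isFlat hF, hA⟩)
      rw [mem_closure_iff_rk M (h.1 ▸ he)] at h3
      omega
  · have h3 : rk N (insert e A) = rk N A := by
      rw [← rk_inter_ground N, insert_inter_of_notMem he, rk_inter_ground]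
    omega

theorem rk_sub_le [M.Finite] (h : IsQuotient M N) {A B : Set α} (hAB : A ⊆ B) :
    rk N B + rk M A ≤ rk M B + rk N A := by
  have H : ∀ S : Set α, S.Finite → rk N (A ∪ S) + rk M A ≤ rk M (A ∪ S) + rk N A := by
    intro S hS
    induction S, hS using Set.Finite.induction_on with
    | empty => simp; omega
    | @insert a s ha hs ih =>
      rw [union_insert]
      have := h.rk_insert a (A ∪ s)
      omega
  have h1 := H (B ∩ M.E) (M.ground_finite.subset inter_subset_right)
  have h2 : (A ∪ B ∩ M.E) ∩ M.E = B ∩ M.E := by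
    ext x
    simp only [mem_inter_iff, mem_union]
    constructor
    · rintro ⟨h1 | h1, h2⟩
      · exact ⟨hAB h1, h2⟩
      · exact h1
    · exact fun h1 => ⟨Or.inr h1, h1.2⟩
  rw [← rk_inter_ground M (A ∪ _), ← rk_inter_ground N (A ∪ _), ← h.1, h2, rk_inter_ground, h.1,
    rk_inter_ground] at h1
  exact h1

theorem rk_le [M.Finite] (h : IsQuotient M N) (A : Set α) : rk N A ≤ rk M A := by
  have := h.rk_sub_le (empty_subset A)
  simp only [rk, Matroid.eRk_empty, ENat.toNat_zero] at this ⊢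
  exact this

theorem of_rk_insert [M.Finite] (hE : M.E = N.E)
    (h : ∀ e A, rk N (insert e A) + rk M A ≤ rk M (insert e A) + rk N A) : IsQuotient M N := by
  have : N.Finite := ⟨hE ▸ M.ground_finite⟩
  refine ⟨hE, fun x hx => hE ▸ hx, fun F hF => ?_⟩
  rw [preimage_id, inter_eq_self_of_subset_left (hE ▸ hF.subset_ground), isFlat_iff_rk]
  rw [isFlat_iff_rk] at hF
  refine ⟨hE ▸ hF.1, fun e he heF => ?_⟩
  have h1 := hF.2 e (hE ▸ he) heF
  have h2 := h e F
  have h3 := rk_insert_le M e F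
  omega

theorem eq_of_rk_ground_eq [M.Finite] (h : IsQuotient M N) (hr : rk M M.E = rk N M.E) :
    M = N := by
  refine eq_of_rk_eq h.1 fun A hA => ?_
  have h1 := h.rk_sub_le hA
  have h2 := h.rk_le A
  omega

theorem isRankFunction_higgs [M.Finite] (h : IsQuotient M N) (i : ℕ) :
    IsRankFunction M.E fun A => min (rk M A) (rk N A + i) where
  empty := by simp [rk]
  inter_ground A := by
    rw [rk_inter_ground M A, h.1, rk_inter_ground N A]
  mono A B hAB := by
    have := h.finite_right
    have h1 := rk_mono M hAB
    have h2 := rk_mono N hAB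
    omega
  insert_le e A := by
    have := h.finite_right
    have h1 := rk_insert_le M e A
    have h2 := rk_insert_le N e A
    omega
  insert_insert x y A hx hy := by
    have := h.finite_right
    by_cases hxy : x = y
    · subst hxy; simpa using hx
    by_cases hxA : x ∈ A
    · rw [insert_eq_of_mem (mem_insert_of_mem _ hxA)]; exact hy
    have hi : insert x A ∩ insert y A = A := by
      ext z
      simp only [mem_inter_iff, mem_insert_iff]
      constructor
      · rintro ⟨rfl | h1, h2⟩
        · exact h2.resolve_left hxy
        · exact h1
      · exact fun h => ⟨Or.inr h, Or.inr h⟩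
    have hu : insert x A ∪ insert y A = insert x (insert y A) := by
      rw [insert_union, union_insert, union_self]
    have sM := rk_submod M (insert x A) (insert y A)
    have sN := rk_submod N (insert x A) (insert y A)
    rw [hi, hu] at sM sN
    have a1 := h.rk_insert x A
    have a2 := h.rk_insert y A
    have a3 := h.rk_insert x (insert y A)
    have a4 := h.rk_insert y (insert x A)
    rw [insert_comm] at a4
    have b1 := rk_mono M (subset_insert x A)
    have b2 := rk_mono M (subset_insert y A)
    have b3 := rk_mono M (subset_insert x (insert y A))
    have b4 := rk_mono N (subset_insert x A)
    have b5 := rk_mono N (subset_insert y A)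
    have b6 := rk_mono N (subset_insert x (insert y A))
    omega

end IsQuotient

/-! ### Higgs lifts -/

/-- The `i`-th Higgs lift of the quotient from `M` to `N`, built from its rank function.
By `higgsLift_isFlat_iff` it is the matroid whose flats are the flats of `N` together with the
flats of `M` of nullity less than `i`. -/
noncomputable def higgsLift {α : Type v} {M N : Matroid α} [M.Finite] (h : IsQuotient M N)
    (i : ℕ) : Matroid α :=
  matroidOfRank M.ground_finite (h.isRankFunction_higgs i)

section higgsLift

variable {α : Type v} {M N : Matroid α} [M.Finite]

instance (h : IsQuotient M N) (i : ℕ) : (higgsLift h i).Finite := ⟨M.ground_finite⟩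

theorem higgsLift_ground (h : IsQuotient M N) (i : ℕ) : (higgsLift h i).E = M.E := rfl

theorem rk_higgsLift (h : IsQuotient M N) (i : ℕ) (A : Set α) :
    rk (higgsLift h i) A = min (rk M A) (rk N A + i) :=
  rk_matroidOfRank _ _ A

/-- The defining property of the Higgs lift. -/
theorem higgsLift_isFlat_iff (h : IsQuotient M N) (i : ℕ) (F : Set α) :
    (higgsLift h i).IsFlat F ↔ N.IsFlat F ∨ (M.IsFlat F ∧ setNullity M N F < i) := by
  have := h.finite_right
  have hle := h.rk_le F
  have key : ∀ e ∈ M.E, e ∉ F → (rk (higgsLift h i) (insert e F) = rk (higgsLift h i) F + 1 ↔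
      (rk N (insert e F) = rk N F + 1 ∨
        (rk M (insert e F) = rk M F + 1 ∧ setNullity M N F < i))) := by
    intro e _ _
    simp only [rk_higgsLift, setNullity]
    have h1 := h.rk_insert e F
    have h2 := rk_insert_le M e F
    have h3 := rk_insert_le N e F
    have h4 := rk_mono M (subset_insert e F)
    have h5 := rk_mono N (subset_insert e F)
    omega
  rw [isFlat_iff_rk, higgsLift_ground]
  by_cases hi : setNullity M N F < i
  · rw [isFlat_iff_rk M]
    constructor
    · rintro ⟨h1, h2⟩
      refine Or.inr ⟨⟨h1, fun e he heF => ?_⟩, hi⟩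
      rcases (key e he heF).1 (h2 e he heF) with h3 | h3
      · have h4 := h.rk_insert e F
        have h5 := rk_insert_le M e F
        omega
      · exact h3.1
    · rintro (hF | hF)
      · have hF := (isFlat_iff_rk N F).1 hF
        exact ⟨h.1 ▸ hF.1, fun e he heF =>
          (key e he heF).2 (Or.inl (hF.2 e (h.1 ▸ he) heF))⟩
      · exact ⟨hF.1.1, fun e he heF => (key e he heF).2 (Or.inr ⟨hF.1.2 e he heF, hi⟩)⟩
  · simp only [hi, and_false, or_false] at key ⊢
    rw [isFlat_iff_rk N, ← h.1]
    exact and_congr_right fun _ => forall_congr' fun e => forall_congr' fun he =>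
      forall_congr' fun heF => key e he heF

end higgsLift

/-! ### Modular cuts and one-element extensions -/

/-- A modular cut of `M`: an upward closed family of flats containing the intersection of any two
of its members that form a modular pair. (The empty family is allowed; it is the modular cut of
the extension by a coloop.) -/
structure IsModularCut {α : Type v} (M : Matroid α) (𝓜 : Set (Set α)) : Prop where
  isFlat : ∀ F ∈ 𝓜, M.IsFlat F
  up : ∀ F ∈ 𝓜, ∀ G, M.IsFlat G → F ⊆ G → G ∈ 𝓜
  inter : ∀ A ∈ 𝓜, ∀ B ∈ 𝓜, rk M A + rk M B = rk M (A ∩ B) + rk M (A ∪ B) → A ∩ B ∈ 𝓜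

open Classical in
/-- The rank function of the one-element extension of `M` by `e` along the modular cut `𝓜`. -/
noncomputable def extensionRank {α : Type v} (M : Matroid α) (𝓜 : Set (Set α)) (e : α)
    (A : Set α) : ℕ :=
  rk M (A \ {e}) + if e ∈ A ∧ M.closure (A \ {e}) ∉ 𝓜 then 1 else 0

section extension

variable {α : Type v} {M : Matroid α} {𝓜 : Set (Set α)} {e : α}

theorem extensionRank_of_notMem {A : Set α} (h : e ∉ A) : extensionRank M 𝓜 e A = rk M A := by
  simp [extensionRank, h]

theorem extensionRank_insert {A : Set α} (h : e ∉ A) (hA : M.closure A ∈ 𝓜) :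
    extensionRank M 𝓜 e (insert e A) = rk M A := by
  simp [extensionRank, h, hA]

theorem extensionRank_insert' {A : Set α} (h : e ∉ A) (hA : M.closure A ∉ 𝓜) :
    extensionRank M 𝓜 e (insert e A) = rk M A + 1 := by
  simp [extensionRank, h, hA]

variable [M.Finite]

theorem closure_eq_of_rk_le {A B : Set α} (hAB : A ⊆ B) (h : rk M B ≤ rk M A) :
    M.closure A = M.closure B :=
  (Matroid.isRkFinite_set M A).closure_eq_closure_of_subset_of_eRk_ge_eRk hAB
    (by rw [← coe_rk, ← coe_rk]; exact_mod_cast h)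

theorem isRankFunction_extensionRank (h : IsModularCut M 𝓜) (he : e ∉ M.E) :
    IsRankFunction (insert e M.E) (extensionRank M 𝓜 e) := by
  have up : ∀ A B : Set α, A ⊆ B → M.closure A ∈ 𝓜 → M.closure B ∈ 𝓜 := fun A B hAB hA =>
    h.up _ hA _ (M.isFlat_closure B) (M.closure_subset_closure hAB)
  have jump : ∀ x y (A : Set α), M.closure A ∉ 𝓜 → M.closure (insert x A) ∈ 𝓜 →
      M.closure (insert y A) ∈ 𝓜 → rk M (insert x (insert y A)) ≤ rk M A + 1 := by
    intro x y A hA hx hy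
    by_contra! hc
    have h1 := rk_insert_le M x A
    have h2 := rk_insert_le M y A
    have h3 := rk_insert_le M x (insert y A)
    have hsub := rk_submod M (M.closure (insert x A)) (M.closure (insert y A))
    have hu : rk M (M.closure (insert x A) ∪ M.closure (insert y A)) =
        rk M (insert x (insert y A)) := by
      rw [← rk_closure, Matroid.closure_closure_union_closure_eq_closure_union, rk_closure,
        insert_union, union_insert, union_self]
    have hi := rk_mono M (subset_inter (M.closure_subset_closure (subset_insert x A))
      (M.closure_subset_closure (subset_insert y A)))
    rw [rk_closure] at hi
    rw [hu, rk_closure, rk_closure] at hsub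
    have hm := h.inter _ hx _ hy (by rw [hu, rk_closure, rk_closure]; omega)
    have hcl := (h.isFlat _ hm).closure
    refine hA ?_
    have hz : M.closure A = M.closure (insert x A) ∩ M.closure (insert y A) := by
      refine subset_antisymm (subset_inter (M.closure_subset_closure (subset_insert x A))
        (M.closure_subset_closure (subset_insert y A))) fun z hz => ?_
      have hzE := Matroid.mem_ground_of_mem_closure hz.1
      rw [mem_closure_iff_rk M hzE]
      have h5 := (mem_closure_iff_rk M hzE _).1 hz.1
      have h6 := (mem_closure_iff_rk M hzE _).1 hz.2
      by_contra hne
      have h7 := rk_mono M (subset_insert z A)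
      have h8 := rk_submod M (insert z (insert x A)) (insert z (insert y A))
      have h9 : insert z A ⊆ insert z (insert x A) ∩ insert z (insert y A) :=
        subset_inter (insert_subset_insert (subset_insert _ _))
          (insert_subset_insert (subset_insert _ _))
      have h10 := rk_mono M h9
      have h11 : insert x (insert y A) ⊆ insert z (insert x A) ∪ insert z (insert y A) := by
        intro w; simp only [mem_insert_iff, mem_union]; tauto
      have h12 := rk_mono M h11
      omega
    rw [hz]; exact hm
  refine ⟨by simp [extensionRank, rk], fun A => ?_, fun A B hAB => ?_, fun x A => ?_,
    fun x y A hx hy => ?_⟩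
  · have h1 : (A ∩ insert e M.E) \ {e} = (A \ {e}) ∩ M.E := by
      ext z
      simp only [mem_sdiff, mem_inter_iff, mem_insert_iff, mem_singleton_iff]
      tauto
    have h2 : (e ∈ A ∩ insert e M.E ∧ M.closure ((A ∩ insert e M.E) \ {e}) ∉ 𝓜) ↔
        (e ∈ A ∧ M.closure (A \ {e}) ∉ 𝓜) := by
      rw [h1, M.closure_inter_ground]
      simp
    unfold extensionRank
    split_ifs with h3 h4 h4
    · rw [h1, rk_inter_ground]
    · exact absurd (h2.1 h3) h4
    · exact absurd (h2.2 h4) h3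
    · rw [h1, rk_inter_ground]
  · have h1 : A \ {e} ⊆ B \ {e} := sdiff_subset_sdiff_left hAB
    have h2 := rk_mono M h1
    unfold extensionRank
    split_ifs with hA hB hB
    · omega
    · have h3 : ¬ rk M (B \ {e}) ≤ rk M (A \ {e}) := fun hc => by
        rw [closure_eq_of_rk_le h1 hc] at hA
        exact hB ⟨hAB hA.1, hA.2⟩
      omega
    · omega
    · omega
  · by_cases hxe : x = e
    · subst hxe
      by_cases hxA : x ∈ A
      · rw [insert_eq_of_mem hxA]; omega
      · rw [extensionRank_of_notMem hxA]
        unfold extensionRank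
        rw [insert_sdiff_self_of_notMem hxA]
        split_ifs <;> omega
    · have h1 : insert x A \ {e} = insert x (A \ {e}) :=
        insert_sdiff_of_notMem _ (by simpa using hxe)
      have h2 := rk_insert_le M x (A \ {e})
      have h3 : e ∈ insert x A ∧ M.closure (insert x A \ {e}) ∉ 𝓜 →
          e ∈ A ∧ M.closure (A \ {e}) ∉ 𝓜 := fun ⟨h4, h5⟩ =>
        ⟨h4.resolve_left (Ne.symm hxe), fun hc => h5 (h1 ▸ up _ _ (subset_insert _ _) hc)⟩
      unfold extensionRank
      rw [h1] at h3 ⊢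
      split_ifs with h4 h5 <;> first | omega | exact absurd (h3 h4) h5
  · by_cases hxA : x ∈ A
    · rw [insert_eq_of_mem (mem_insert_of_mem _ hxA)]; exact hy
    by_cases hyA : y ∈ A
    · rw [insert_eq_of_mem hyA]; exact hx
    by_cases hxy : x = y
    · subst hxy; simpa using hx
    have key : ∀ x y : α, x ≠ e → y ≠ e → ∀ A : Set α, e ∉ A →
        rk M (insert x A) = rk M A → rk M (insert y A) = rk M A →
        rk M (insert x (insert y A)) = rk M A := by
      intro x y _ _ A _ h1 h2
      rw [← rk_closure, insert_comm, ← Matroid.closure_insert_closure_eq_closure_insert,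
        ← closure_eq_of_rk_le (subset_insert x A) h1.le,
        Matroid.closure_insert_closure_eq_closure_insert, rk_closure, h2]
    by_cases heA : e ∈ A
    · have hxe : x ≠ e := fun h => hxA (h ▸ heA)
      have hye : y ≠ e := fun h => hyA (h ▸ heA)
      obtain ⟨B, heB, rfl⟩ : ∃ B, e ∉ B ∧ A = insert e B :=
        ⟨A \ {e}, by simp, by rw [insert_sdiff_singleton, insert_eq_of_mem heA]⟩
      have hx' : e ∉ insert x B := by simp [heB, hxe.symm]
      have hy' : e ∉ insert y B := by simp [heB, hye.symm]
      have hxy' : e ∉ insert x (insert y B) := by simp [heB, hxe.symm, hye.symm]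
      have ux := up _ _ (subset_insert x B)
      have uy := up _ _ (subset_insert y B)
      have uxy := up _ _ (subset_insert x (insert y B))
      have uyx := up _ _ (subset_insert y (insert x B))
      rw [insert_comm y x B] at uyx
      have b1 := rk_mono M (subset_insert x B)
      have b2 := rk_mono M (subset_insert y B)
      have b3 := rk_mono M (subset_insert x (insert y B))
      have b4 := rk_insert_le M x (insert y B)
      have b5 := rk_mono M (subset_insert y (insert x B))
      have b6 := rk_insert_le M y (insert x B)
      rw [insert_comm y x B] at b5 b6
      have cx := closure_eq_of_rk_le (M := M) (subset_insert x B)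
      have cy := closure_eq_of_rk_le (M := M) (subset_insert y B)
      have cxy := closure_eq_of_rk_le (M := M) (subset_insert x (insert y B))
      have k := key x y hxe hye B heB
      have j := jump x y B
      rw [insert_comm y e B, insert_comm x e]
      rw [insert_comm x e B] at hx
      rw [insert_comm y e B] at hy
      by_cases hB : M.closure B ∈ 𝓜
      · rw [extensionRank_insert heB hB] at hx hy ⊢
        rw [extensionRank_insert hx' (ux hB)] at hx
        rw [extensionRank_insert hy' (uy hB)] at hy
        rw [extensionRank_insert hxy' (uxy (uy hB))]
        exact k hx hy
      · rw [extensionRank_insert' heB hB] at hx hy ⊢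
        by_cases hX : M.closure (insert x B) ∈ 𝓜 <;> by_cases hY : M.closure (insert y B) ∈ 𝓜
        · rw [extensionRank_insert hx' hX] at hx
          rw [extensionRank_insert hy' hY] at hy
          rw [extensionRank_insert hxy' (uyx hX)]
          have := j hB hX hY
          omega
        · rw [extensionRank_insert hx' hX] at hx
          rw [extensionRank_insert' hy' hY] at hy
          rw [extensionRank_insert hxy' (uyx hX)]
          omega
        · rw [extensionRank_insert' hx' hX] at hx
          rw [extensionRank_insert hy' hY] at hy
          rw [extensionRank_insert hxy' (uxy hY)]
          have : ¬ rk M (insert x B) = rk M B + 1 := by omega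
          have h3 : rk M (insert x (insert y B)) ≤ rk M (insert y B) := by
            rw [← rk_closure M (insert y B), ← rk_closure M (insert x (insert y B)),
              insert_comm, ← Matroid.closure_insert_closure_eq_closure_insert, ← cx (by omega),
              Matroid.closure_insert_closure_eq_closure_insert]
          omega
        · rw [extensionRank_insert' hx' hX] at hx
          rw [extensionRank_insert' hy' hY] at hy
          have h3 := k (by omega) (by omega)
          have h4 : M.closure (insert x (insert y B)) = M.closure (insert y B) :=
            (cxy (by omega)).symm
          rw [extensionRank_insert' hxy' (h4 ▸ hY), h3]
    · rw [extensionRank_of_notMem heA] at hx hy ⊢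
      by_cases hxe : x = e
      · subst hxe
        have hye : y ≠ x := Ne.symm hxy
        have hy' : x ∉ insert y A := by simp [heA, hxy]
        have hcA : M.closure A ∈ 𝓜 := by
          by_contra hc
          rw [extensionRank_insert' heA hc] at hx
          omega
        rw [extensionRank_insert hy' (up _ _ (subset_insert y A) hcA)]
        rwa [extensionRank_of_notMem hy'] at hy
      · have hx' : e ∉ insert x A := by simp [heA, Ne.symm hxe]
        by_cases hye : y = e
        · subst hye
          have hcA : M.closure A ∈ 𝓜 := by
            by_contra hc
            rw [extensionRank_insert' heA hc] at hy
            omega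
          rw [insert_comm, extensionRank_insert hx' (up _ _ (subset_insert x A) hcA)]
          rwa [extensionRank_of_notMem hx'] at hx
        · have hy' : e ∉ insert y A := by simp [heA, Ne.symm hye]
          have hxy' : e ∉ insert x (insert y A) := by simp [heA, Ne.symm hxe, Ne.symm hye]
          rw [extensionRank_of_notMem hx'] at hx
          rw [extensionRank_of_notMem hy'] at hy
          rw [extensionRank_of_notMem hxy']
          exact key x y hxe hye A heA hx hy

/-- The one-element extension of `M` by a new element `e` along the modular cut `𝓜`, built from
its rank function. By `extension_delete` and `mem_modularCut_iff` it is an extension of `M`, and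
`𝓜` consists of the flats `F` of `M` such that, in the extension, `F ∪ {e}` is a flat and `F` is
not. -/
noncomputable def extension (M : Matroid α) [M.Finite] (𝓜 : Set (Set α)) (h : IsModularCut M 𝓜)
    (e : α) (he : e ∉ M.E) : Matroid α :=
  matroidOfRank (M.ground_finite.insert e) (isRankFunction_extensionRank h he)

instance (h : IsModularCut M 𝓜) (he : e ∉ M.E) : (extension M 𝓜 h e he).Finite :=
  ⟨M.ground_finite.insert e⟩

theorem extension_ground (h : IsModularCut M 𝓜) (he : e ∉ M.E) :
    (extension M 𝓜 h e he).E = insert e M.E := rfl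

theorem rk_extension (h : IsModularCut M 𝓜) (he : e ∉ M.E) (A : Set α) :
    rk (extension M 𝓜 h e he) A = extensionRank M 𝓜 e A :=
  rk_matroidOfRank _ _ A

theorem rk_delete (M : Matroid α) {D A : Set α} (h : Disjoint A D) :
    rk (M.delete D) A = rk M A := by
  rw [rk, rk, Matroid.delete_eq_restrict, Matroid.restrict_eRk_eq', ← inter_sdiff_assoc,
    (h.mono_left inter_subset_left).sdiff_eq_left, Matroid.eRk_inter_ground]

theorem extension_delete (h : IsModularCut M 𝓜) (he : e ∉ M.E) :
    (extension M 𝓜 h e he).delete {e} = M := by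
  have hE : M.E = ((extension M 𝓜 h e he).delete {e}).E := by
    rw [Matroid.delete_ground, extension_ground, insert_sdiff_self_of_notMem he]
  refine (eq_of_rk_eq hE fun A hA => ?_).symm
  have heA : e ∉ A := fun hc => he (hA hc)
  rw [rk_delete _ (by simpa using heA), rk_extension, extensionRank_of_notMem heA]

theorem mem_modularCut_iff (h : IsModularCut M 𝓜) (he : e ∉ M.E) {F : Set α}
    (hF : M.IsFlat F) : F ∈ 𝓜 ↔ ¬ (extension M 𝓜 h e he).IsFlat F ∧
      (extension M 𝓜 h e he).IsFlat (insert e F) := by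
  have heF : e ∉ F := fun hc => he (hF.subset_ground hc)
  have hF' := (isFlat_iff_rk M F).1 hF
  rw [isFlat_iff_rk, isFlat_iff_rk, extension_ground]
  simp only [rk_extension]
  constructor
  · intro hm
    have hm' : M.closure F ∈ 𝓜 := hF.closure.symm ▸ hm
    refine ⟨fun hc => ?_, insert_subset_insert hF'.1, fun x hx hxF => ?_⟩
    · have := hc.2 e (mem_insert _ _) heF
      rw [extensionRank_insert heF hm', extensionRank_of_notMem heF] at this
      omega
    · have hxe : x ≠ e := fun hc => hxF (hc ▸ mem_insert _ _)
      have hx' : e ∉ insert x F := by simp [heF, hxe.symm]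
      rw [insert_comm, extensionRank_insert heF hm', extensionRank_insert hx'
        (h.up _ hm' _ (M.isFlat_closure _) (M.closure_subset_closure (subset_insert x F)))]
      exact hF'.2 x (hx.resolve_left hxe) fun hc => hxF (mem_insert_of_mem _ hc)
  · rintro ⟨h1, -⟩
    by_contra hm
    have hm' : M.closure F ∉ 𝓜 := hF.closure.symm ▸ hm
    refine h1 ⟨hF'.1.trans (subset_insert _ _), fun x hx hxF => ?_⟩
    rcases eq_or_ne x e with rfl | hxe
    · rw [extensionRank_insert' heF hm', extensionRank_of_notMem heF]
    · have hx' : e ∉ insert x F := by simp [heF, hxe.symm]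
      rw [extensionRank_of_notMem hx', extensionRank_of_notMem heF]
      exact hF'.2 x (hx.resolve_left hxe) hxF

end extension

/-! ### Flag matroids and the Higgs factorization -/

/-- The rank of a matroid (with finite ground set). -/
noncomputable def rank {α : Type v} (M : Matroid α) : ℕ := rk M M.E

theorem IsQuotient.refl {α : Type v} (M : Matroid α) : IsQuotient M M :=
  ⟨rfl, fun _ hx => hx, fun F hF => by
    rwa [preimage_id, inter_eq_self_of_subset_left hF.subset_ground]⟩

theorem IsQuotient.trans {α : Type v} {M N P : Matroid α} (h : IsQuotient M N)
    (h' : IsQuotient N P) : IsQuotient M P :=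
  ⟨h.1.trans h'.1, fun _ hx => (h.1.trans h'.1) ▸ hx, fun F hF => by
    rw [preimage_id, inter_eq_self_of_subset_left
      (h.1 ▸ h'.1 ▸ hF.subset_ground)]
    exact h.isFlat (h'.isFlat hF)⟩

/-- A flag matroid of length `l`: a chain of `l` successive quotients of matroids on a common
finite ground set, `matroid 0 ↠ matroid 1 ↠ ⋯ ↠ matroid l`. -/
structure FlagMatroid (α : Type v) (l : ℕ) where
  matroid : Fin (l + 1) → Matroid α
  finite : ∀ i, (matroid i).Finite
  isQuotient : ∀ i : Fin l, IsQuotient (matroid i.castSucc) (matroid i.succ)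

namespace FlagMatroid

variable {α : Type v} {l : ℕ} (F : FlagMatroid α l)

attribute [instance] FlagMatroid.finite

/-- The nullity of the quotient from the first matroid of the flag to the `i`-th one. -/
noncomputable def nullityTo (i : Fin (l + 1)) : ℕ := rank (F.matroid 0) - rank (F.matroid i)

/-- The nullity of the quotient from the first matroid of the flag to the last one. -/
noncomputable def nullity : ℕ := F.nullityTo (Fin.last l)

/-- A flag all of whose quotients are elementary. Such a flag is a factorization of the quotient
from its first to its last matroid. -/
def IsElementary : Prop :=
  ∀ i : Fin l, rank (F.matroid i.castSucc) = rank (F.matroid i.succ) + 1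

open Classical in
/-- The terms `N₀, N₁, …, N_k` of the Higgs factorization of a flag matroid
`M₀ ↠ M₁ ↠ ⋯ ↠ M_l` of nullity `k`. They are obtained by writing one after the other the Higgs
factorizations of the steps `fⱼ : Mⱼ ↠ Mⱼ₊₁`: if `nⱼ` is the nullity of `M₀ ↠ Mⱼ`, then
`N_t = L^(nⱼ₊₁ - t)(fⱼ)` for `nⱼ ≤ t < nⱼ₊₁` (the index `j` is unique), and `N_k = M_l`. -/
noncomputable def higgsTerm (t : ℕ) : Matroid α :=
  if h : ∃ j : Fin l, F.nullityTo j.castSucc ≤ t ∧ t < F.nullityTo j.succ then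
    higgsLift (F.isQuotient h.choose) (F.nullityTo h.choose.succ - t)
  else F.matroid (Fin.last l)

instance (t : ℕ) : (F.higgsTerm t).Finite := by
  unfold higgsTerm
  split_ifs <;> infer_instance

theorem isQuotient_of_le {i j : Fin (l + 1)} (h : i ≤ j) :
    IsQuotient (F.matroid i) (F.matroid j) := by
  induction j using Fin.induction with
  | zero => rw [Fin.le_zero_iff.1 h]; exact IsQuotient.refl _
  | succ j ih =>
    rcases h.lt_or_eq with h | h
    · exact (ih (Fin.le_castSucc_iff.2 h)).trans (F.isQuotient j)
    · rw [h]; exact IsQuotient.refl _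

theorem ground_eq (i : Fin (l + 1)) : (F.matroid i).E = (F.matroid 0).E :=
  (F.isQuotient_of_le (Fin.zero_le i)).1.symm

theorem rank_eq (i : Fin (l + 1)) : rank (F.matroid i) = rk (F.matroid i) (F.matroid 0).E := by
  rw [rank, F.ground_eq]

theorem rank_anti {i j : Fin (l + 1)} (h : i ≤ j) :
    rank (F.matroid j) ≤ rank (F.matroid i) := by
  rw [rank_eq, rank_eq]
  exact (F.isQuotient_of_le h).rk_le _

theorem nullityTo_add_rank (i : Fin (l + 1)) :
    F.nullityTo i + rank (F.matroid i) = rank (F.matroid 0) := by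
  have := F.rank_anti (Fin.zero_le i)
  rw [nullityTo]; omega

theorem nullityTo_mono {i j : Fin (l + 1)} (h : i ≤ j) : F.nullityTo i ≤ F.nullityTo j := by
  have := F.rank_anti h
  rw [nullityTo, nullityTo]; omega

theorem matroid_eq_of_nullityTo_eq {i j : Fin (l + 1)} (hij : i ≤ j)
    (h : F.nullityTo i = F.nullityTo j) : F.matroid i = F.matroid j := by
  refine (F.isQuotient_of_le hij).eq_of_rk_ground_eq ?_
  have h1 := F.nullityTo_add_rank i
  have h2 := F.nullityTo_add_rank j
  rw [rank_eq] at h1 h2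
  rw [F.ground_eq]
  omega

theorem exists_step {t : ℕ} (ht : t < F.nullity) :
    ∃ j : Fin l, F.nullityTo j.castSucc ≤ t ∧ t < F.nullityTo j.succ := by
  by_contra! hc
  have H : ∀ i, F.nullityTo i ≤ t := by
    intro i
    induction i using Fin.induction with
    | zero => simp [nullityTo]
    | succ j ih => exact hc j ih
  exact absurd (H (Fin.last l)) (not_le.2 ht)

theorem rk_higgsTerm {t : ℕ} (j : Fin l) (h1 : F.nullityTo j.castSucc ≤ t)
    (h2 : t ≤ F.nullityTo j.succ) (A : Set α) : rk (F.higgsTerm t) A =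
      min (rk (F.matroid j.castSucc) A) (rk (F.matroid j.succ) A + (F.nullityTo j.succ - t)) := by
  unfold higgsTerm
  have hjle := (F.isQuotient j).rk_le A
  split_ifs with h
  · obtain ⟨h3, h4⟩ := h.choose_spec
    rw [rk_higgsLift]
    generalize h.choose = i at h3 h4 ⊢
    rcases lt_trichotomy i j with hij | rfl | hij
    · have := F.nullityTo_mono (show i.succ ≤ j.castSucc from hij)
      omega
    · rfl
    · have h5 := F.nullityTo_mono (show j.succ ≤ i.castSucc from hij)
      have h6 := F.matroid_eq_of_nullityTo_eq (show j.succ ≤ i.castSucc from hij) (by omega)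
      have h7 : F.nullityTo j.succ - t = 0 := by omega
      have h8 : rk (F.matroid i.castSucc) A ≤
          rk (F.matroid i.succ) A + (F.nullityTo i.succ - t) := by
        have h9 := (F.isQuotient i).rk_sub_le (A := A ∩ (F.matroid 0).E) inter_subset_right
        have h10 := F.nullityTo_add_rank i.castSucc
        have h11 := F.nullityTo_add_rank i.succ
        rw [rank_eq] at h10 h11
        have e1 : ∀ i, rk (F.matroid i) (A ∩ (F.matroid 0).E) = rk (F.matroid i) A := fun i => by
          rw [← F.ground_eq i, rk_inter_ground]
        rw [e1, e1] at h9
        omega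
      rw [h7, min_eq_left h8, h6.symm, min_eq_right (by omega), add_zero]
  · have h3 : F.nullity ≤ t := by
      by_contra! hc
      exact h (F.exists_step hc)
    have h4 := F.nullityTo_mono (Fin.le_last j.succ)
    rw [nullity] at h3
    have h5 := F.matroid_eq_of_nullityTo_eq (Fin.le_last j.succ) (by omega)
    have h7 : F.nullityTo j.succ - t = 0 := by omega
    rw [← h5, h7, add_zero, min_eq_right hjle]

/-- The matroids of the flag occur in its Higgs factorization. -/
theorem higgsTerm_nullityTo (i : Fin (l + 1)) : F.higgsTerm (F.nullityTo i) = F.matroid i := by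
  induction i using Fin.lastCases with
  | last =>
    unfold higgsTerm
    rw [dif_neg]
    rintro ⟨j, -, h2⟩
    exact absurd (F.nullityTo_mono (Fin.le_last j.succ)) (not_le.2 h2)
  | cast j =>
    have h1 := F.nullityTo_mono (Fin.castSucc_le_succ j)
    have hE : (F.higgsTerm (F.nullityTo j.castSucc)).E = (F.matroid j.castSucc).E := by
      rw [F.ground_eq]
      unfold higgsTerm
      split_ifs with h
      · rw [higgsLift_ground, F.ground_eq]
      · exact F.ground_eq _
    refine eq_of_rk_eq hE fun A hA => ?_
    rw [F.rk_higgsTerm j le_rfl h1, min_eq_left]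
    rw [hE] at hA
    have h2 := (F.isQuotient j).rk_sub_le hA
    have h3 := F.nullityTo_add_rank j.castSucc
    have h4 := F.nullityTo_add_rank j.succ
    rw [rank] at h3
    rw [rank, ← (F.isQuotient j).1] at h4
    omega

theorem higgsTerm_ground (t : ℕ) : (F.higgsTerm t).E = (F.matroid 0).E := by
  unfold higgsTerm
  split_ifs with h
  · rw [higgsLift_ground, F.ground_eq]
  · exact F.ground_eq _

theorem higgsTerm_isQuotient {t : ℕ} (ht : t < F.nullity) :
    IsQuotient (F.higgsTerm t) (F.higgsTerm (t + 1)) := by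
  obtain ⟨j, h1, h2⟩ := F.exists_step ht
  refine IsQuotient.of_rk_insert (by rw [higgsTerm_ground, higgsTerm_ground]) fun e A => ?_
  rw [F.rk_higgsTerm j h1 h2.le, F.rk_higgsTerm j h1 h2.le, F.rk_higgsTerm j (by omega) (by omega),
    F.rk_higgsTerm j (by omega) (by omega)]
  have a1 := (F.isQuotient j).rk_insert e A
  have a2 := rk_insert_le (F.matroid j.castSucc) e A
  have a3 := rk_insert_le (F.matroid j.succ) e A
  have a4 := rk_mono (F.matroid j.castSucc) (subset_insert e A)
  have a5 := rk_mono (F.matroid j.succ) (subset_insert e A)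
  omega

/-- The Higgs factorization of a flag matroid. -/
noncomputable def higgsFactorization : FlagMatroid α F.nullity where
  matroid t := F.higgsTerm t
  finite _ := inferInstance
  isQuotient t := F.higgsTerm_isQuotient t.2

theorem higgsFactorization_isElementary : F.higgsFactorization.IsElementary := by
  intro t
  obtain ⟨j, h1, h2⟩ := F.exists_step t.2
  change rank (F.higgsTerm t) = rank (F.higgsTerm (t + 1)) + 1
  rw [rank, rank, higgsTerm_ground, higgsTerm_ground, F.rk_higgsTerm j h1 h2.le,
    F.rk_higgsTerm j (by omega) (by omega), ← rank_eq, ← rank_eq]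
  have := F.nullityTo_add_rank j.castSucc
  have := F.nullityTo_add_rank j.succ
  omega

end FlagMatroid
/-! ### The major of a factorization -/

/-- The modular cut of an elementary quotient from `M` to `N`: the flats of `M` of nullity one. -/
def elementaryCut {α : Type v} (M N : Matroid α) : Set (Set α) :=
  {G | M.IsFlat G ∧ setNullity M N G = 1}

theorem rk_map_image {α : Type v} {β : Type w} (M : Matroid α) {f : α → β}
    (hf : Function.Injective f) (A : Set α) : rk (M.map f hf.injOn) (f '' A) = rk M A := by
  obtain ⟨I, hI⟩ := M.exists_isBasis (A ∩ M.E)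
  have h1 := hI.map hf.injOn
  rw [← rk_inter_ground M A, ← rk_inter_ground _ (f '' A), Matroid.map_ground, ← image_inter hf, rk,
    rk, ← hI.encard_eq_eRk, ← h1.encard_eq_eRk, hf.encard_image]

section lift

variable {α : Type v} {γ : Type w} {H : Matroid (α ⊕ γ)} [H.Finite] {M N : Matroid α} [M.Finite]
  {S : Set γ} {c : ℕ}

/-- Here `M = H / C` for `C = Sum.inr '' S`, and the sets `G ∪ C`, where `G` runs over the modular
cut of an elementary quotient of `M`, form a modular cut of `H`. -/
theorem isModularCut_lift (h : IsQuotient M N) (hr : rank M = rank N + 1)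
    (hE : H.E = Sum.inl '' M.E ∪ Sum.inr '' S)
    (hrk : ∀ A, rk H (Sum.inl '' A ∪ Sum.inr '' S) = rk M A + c) :
    IsModularCut H ((fun G => Sum.inl '' G ∪ Sum.inr '' S) '' elementaryCut M N) := by
  have hr' : rk M M.E = rk N M.E + 1 := by rw [← rank, hr, rank, h.1]
  have flat : ∀ G, H.IsFlat (Sum.inl '' G ∪ Sum.inr '' S) ↔ M.IsFlat G := by
    intro G
    rw [isFlat_iff_rk, isFlat_iff_rk, hE]
    constructor
    · rintro ⟨h1, h2⟩
      refine ⟨fun x hx => ?_, fun e he heG => ?_⟩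
      · simpa using h1 (Or.inl (mem_image_of_mem _ hx))
      · have := h2 (Sum.inl e) (by simpa using he) (by simpa using heG)
        rw [← insert_union, ← image_insert_eq, hrk, hrk] at this
        omega
    · rintro ⟨h1, h2⟩
      refine ⟨union_subset_union_left _ (image_mono h1), ?_⟩
      rintro (e | s) he heG
      · have := h2 e (by simpa using he) (by simpa using heG)
        rw [← insert_union, ← image_insert_eq, hrk, hrk]
        omega
      · simp only [mem_union, mem_image, reduceCtorEq, and_false, exists_false, Sum.inr.injEq,
          exists_eq_right, false_or] at he heG
        exact absurd he heG
  have bound : ∀ G ⊆ M.E, rk M G ≤ rk N G + 1 := fun G hG => by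
    have := h.rk_sub_le hG
    omega
  refine ⟨?_, ?_, ?_⟩
  · rintro _ ⟨G, hG, rfl⟩
    exact (flat G).2 hG.1
  · rintro _ ⟨G, hG, rfl⟩ B hB hGB
    obtain ⟨A, rfl⟩ : ∃ A : Set α, B = Sum.inl '' A ∪ Sum.inr '' S := by
      refine ⟨Sum.inl ⁻¹' B, subset_antisymm ?_ ?_⟩
      · have := hB.subset_ground
        rw [hE] at this
        rintro (x | s) hx
        · exact Or.inl ⟨x, hx, rfl⟩
        · rcases this hx with ⟨_, _, h⟩ | h
          · cases h
          · exact Or.inr h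
      · rintro _ (⟨x, hx, rfl⟩ | hs)
        · exact hx
        · exact hGB (Or.inr hs)
    have hA := (flat A).1 hB
    have hGA : G ⊆ A := fun x hx => by simpa using hGB (Or.inl (mem_image_of_mem _ hx))
    refine ⟨A, ⟨hA, ?_⟩, rfl⟩
    have h1 := h.rk_sub_le hGA
    have h2 := bound A hA.subset_ground
    have h3 := hG.2
    unfold setNullity at h3 ⊢
    omega
  · rintro _ ⟨A, hA, rfl⟩ _ ⟨B, hB, rfl⟩ hAB
    have hi : (Sum.inl '' A ∪ Sum.inr '' S) ∩ (Sum.inl '' B ∪ Sum.inr '' S) =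
        (Sum.inl '' (A ∩ B) ∪ Sum.inr '' S : Set (α ⊕ γ)) := by
      rw [← inter_union_distrib_right, image_inter Sum.inl_injective]
    have hu : (Sum.inl '' A ∪ Sum.inr '' S) ∪ (Sum.inl '' B ∪ Sum.inr '' S) =
        (Sum.inl '' (A ∪ B) ∪ Sum.inr '' S : Set (α ⊕ γ)) := by
      rw [← union_union_distrib_right, image_union]
    simp only [hi, hu, hrk] at hAB ⊢
    have hfl : M.IsFlat (A ∩ B) := by
      rw [Matroid.isFlat_iff_closure_eq]
      refine subset_antisymm (subset_inter ?_ ?_)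
        (M.subset_closure _ (inter_subset_left.trans hA.1.subset_ground))
      · exact (M.closure_subset_closure inter_subset_left).trans hA.1.closure.subset
      · exact (M.closure_subset_closure inter_subset_right).trans hB.1.closure.subset
    refine ⟨A ∩ B, ⟨hfl, ?_⟩, rfl⟩
    have hN := h.finite_right
    have h1 := bound (A ∩ B) hfl.subset_ground
    have h2 := bound (A ∪ B) (union_subset hA.1.subset_ground hB.1.subset_ground)
    have h3 := rk_submod N A B
    have h4 := hA.2
    have h5 := hB.2
    have h6 := h.rk_sub_le (subset_union_left (s := A) (t := B))
    unfold setNullity at h4 h5 ⊢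
    omega

/-- Extending `H` along the modular cut of `isModularCut_lift` by `e` and contracting `C ∪ {e}`
gives `N`. -/
theorem rk_extension_lift (h : IsQuotient M N) (hr : rank M = rank N + 1)
    (hE : H.E = Sum.inl '' M.E ∪ Sum.inr '' S)
    (hrk : ∀ A, rk H (Sum.inl '' A ∪ Sum.inr '' S) = rk M A + c) {s : γ}
    (hs : Sum.inr s ∉ H.E) (A : Set α) :
    rk (extension H _ (isModularCut_lift h hr hE hrk) (Sum.inr s) hs)
      (Sum.inl '' A ∪ Sum.inr '' insert s S) = rk N A + (c + 1) := by
  have hN := h.finite_right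
  have hr' : rk M M.E = rk N M.E + 1 := by rw [← rank, hr, rank, h.1]
  have hsS : s ∉ S := fun hc => hs (hE ▸ Or.inr (mem_image_of_mem _ hc))
  have hsA : (Sum.inr s : α ⊕ γ) ∉ Sum.inl '' A ∪ Sum.inr '' S := by simpa using hsS
  have hle := h.rk_le A
  -- the closure of `A` in `M` has the same nullity as `A`
  have hn : rk N (M.closure A) = rk N A := by
    have h1 : rk N (M.closure A) ≤ rk N (N.closure A) := by
      refine rk_mono N ?_
      have hA : A ∩ M.E ⊆ N.closure A := by
        rw [h.1, ← N.closure_inter_ground]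
        exact N.subset_closure _ inter_subset_right
      rw [Matroid.closure_def]
      exact sInter_subset_of_mem ⟨h.isFlat (N.isFlat_closure A), hA⟩
    have h2 : rk N (A ∩ N.E) ≤ rk N (M.closure A) := by
      refine rk_mono N ?_
      rw [← h.1, ← M.closure_inter_ground]
      exact M.subset_closure _ inter_subset_right
    rw [rk_closure] at h1
    rw [rk_inter_ground] at h2
    exact le_antisymm h1 h2
  have hcl : H.closure (Sum.inl '' A ∪ Sum.inr '' S) =
      Sum.inl '' (M.closure A) ∪ Sum.inr '' S := by
    ext x
    constructor
    · intro hx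
      have hxE := Matroid.mem_ground_of_mem_closure hx
      rw [mem_closure_iff_rk H hxE] at hx
      rw [hE] at hxE
      rcases x with x | t
      · have hxM : x ∈ M.E := by simpa using hxE
        rw [← insert_union, ← image_insert_eq, hrk, hrk] at hx
        exact Or.inl ⟨x, (mem_closure_iff_rk M hxM A).2 (by omega), rfl⟩
      · exact hxE.resolve_left (by rintro ⟨_, _, h⟩; cases h) |> Or.inr
    · rintro (⟨x, hx, rfl⟩ | hx)
      · have hxM := Matroid.mem_ground_of_mem_closure hx
        rw [mem_closure_iff_rk M hxM] at hx
        rw [mem_closure_iff_rk H (hE ▸ Or.inl (mem_image_of_mem _ hxM)), ← insert_union,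
          ← image_insert_eq, hrk, hrk, hx]
      · rw [mem_closure_iff_rk H (hE ▸ Or.inr hx), insert_eq_of_mem (mem_union_right _ hx)]
  have hmem : H.closure (Sum.inl '' A ∪ Sum.inr '' S) ∈
      (fun G => (Sum.inl '' G ∪ Sum.inr '' S : Set (α ⊕ γ))) '' elementaryCut M N ↔
      setNullity M N A = 1 := by
    have hsn : setNullity M N (M.closure A) = setNullity M N A := by
      rw [setNullity, setNullity, hn, rk_closure]
    rw [hcl]
    constructor
    · rintro ⟨G, hG, hGA⟩
      have : G = M.closure A := by
        ext x
        have := Set.ext_iff.1 hGA (Sum.inl x)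
        simpa using this
      rw [← hsn, ← this]; exact hG.2
    · exact fun hA => ⟨_, ⟨M.isFlat_closure A, hsn.trans hA⟩, rfl⟩
  have hb : rk M A ≤ rk N A + 1 := by
    have h1 := h.rk_sub_le (inter_subset_right : A ∩ M.E ⊆ M.E)
    rw [rk_inter_ground] at h1
    rw [h.1, rk_inter_ground, ← h.1] at h1
    omega
  rw [rk_extension, image_insert_eq, union_insert]
  by_cases hA : setNullity M N A = 1
  · rw [extensionRank_insert hsA (hmem.2 hA), hrk]
    unfold setNullity at hA
    omega
  · rw [extensionRank_insert' hsA (fun hc => hA (hmem.1 hc)), hrk]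
    unfold setNullity at hA
    omega

end lift

namespace FlagMatroid

variable {α : Type v} {k : ℕ}

/-- The labels of the first `i` of the `k` new elements. -/
def labels (k i : ℕ) : Set (Fin k) := {j | j.1 < i}

/-- The first `i` steps `H_i` of the construction of the major of a factorization
`N₀ ↠ N₁ ↠ ⋯ ↠ N_k`, with ground set `E ∪ {e₁, …, e_i}`; here `E` is embedded by `Sum.inl` and
`e_{j+1} = Sum.inr j`. We start with `H₀ = N₀`, and `H_{i+1}` is the one-element extension of `H_i`
by `e_{i+1}` along the modular cut `{G ∪ {e₁, …, e_i} : G ∈ 𝓜}`, where `𝓜` is the modular cut of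
`N_i` which corresponds to the elementary quotient `N_i ↠ N_{i+1}`. The last two properties carried
along say that `H_i / {e₁, …, e_i} = N_i` and `H_i \ {e₁, …, e_i} = N₀`. -/
noncomputable def majorAux (N : FlagMatroid α k) (hN : N.IsElementary) : (i : ℕ) → (hi : i ≤ k) →
    {H : Matroid (α ⊕ Fin k) // H.Finite ∧
      H.E = Sum.inl '' (N.matroid ⟨i, Nat.lt_succ_of_le hi⟩).E ∪ Sum.inr '' labels k i ∧
      (∀ A, rk H (Sum.inl '' A ∪ Sum.inr '' labels k i) =
        rk (N.matroid ⟨i, Nat.lt_succ_of_le hi⟩) A + i) ∧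
      ∀ A, rk H (Sum.inl '' A) = rk (N.matroid 0) A}
  | 0, _ => ⟨(N.matroid 0).map Sum.inl Sum.inl_injective.injOn, inferInstance,
      by simp [labels], fun A => by simpa [labels] using rk_map_image _ Sum.inl_injective A,
      rk_map_image _ Sum.inl_injective⟩
  | i + 1, hi =>
    let H := majorAux N hN i (Nat.le_of_succ_le hi)
    let j : Fin k := ⟨i, hi⟩
    have : H.1.Finite := H.2.1
    have hs : (Sum.inr j : α ⊕ Fin k) ∉ H.1.E := by
      rw [H.2.2.1]; simp [labels, j]
    ⟨extension H.1
      ((fun G => Sum.inl '' G ∪ Sum.inr '' labels k i) ''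
        elementaryCut (N.matroid j.castSucc) (N.matroid j.succ))
      (isModularCut_lift (N.isQuotient j) (hN j) H.2.2.1 H.2.2.2.1) (Sum.inr j) hs,
      inferInstance,
      by
        have hl : labels k (i + 1) = insert j (labels k i) := by
          ext x; simp [labels, j, Fin.ext_iff]; omega
        rw [extension_ground, H.2.2.1, hl, image_insert_eq, union_insert,
          (N.isQuotient_of_le (i := ⟨i, _⟩) (j := ⟨i + 1, _⟩)
            (Fin.mk_le_mk.2 (Nat.le_succ i))).1],
      fun A => by
        have hl : labels k (i + 1) = insert j (labels k i) := by
          ext x; simp [labels, j, Fin.ext_iff]; omega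
        rw [hl]
        exact rk_extension_lift (N.isQuotient j) (hN j) H.2.2.1 H.2.2.2.1 hs A,
      fun A => by
        rw [rk_extension, extensionRank_of_notMem (by simp), H.2.2.2.2]⟩

/-- The major of a factorization `N₀ ↠ N₁ ↠ ⋯ ↠ N_k`, a matroid on `E ∪ {e₁, …, e_k}`. -/
noncomputable def major (N : FlagMatroid α k) (hN : N.IsElementary) : Matroid (α ⊕ Fin k) :=
  (N.majorAux hN k le_rfl).1

theorem labels_self (k : ℕ) : labels k k = univ := by
  ext x; simp [labels]

theorem major_ground (N : FlagMatroid α k) (hN : N.IsElementary) :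
    (N.major hN).E = Sum.inl '' (N.matroid 0).E ∪ range Sum.inr := by
  rw [major, (N.majorAux hN k le_rfl).2.2.1, labels_self, image_univ, N.ground_eq]

/-- Deleting the new elements from the major gives the first matroid of the factorization. -/
theorem major_delete (N : FlagMatroid α k) (hN : N.IsElementary) :
    (N.major hN).delete (range Sum.inr) =
      (N.matroid 0).map Sum.inl Sum.inl_injective.injOn := by
  have hf : (N.major hN).Finite := (N.majorAux hN k le_rfl).2.1
  have hE : ((N.matroid 0).map (Sum.inl : α → α ⊕ Fin k) Sum.inl_injective.injOn).E =
      ((N.major hN).delete (range Sum.inr)).E := by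
    rw [Matroid.map_ground, Matroid.delete_ground, major_ground]
    ext (x | x) <;> simp
  refine (eq_of_rk_eq hE fun A hA => ?_).symm
  rw [Matroid.map_ground] at hA
  obtain ⟨B, -, rfl⟩ := subset_image_iff.1 hA
  have hd : Disjoint (Sum.inl '' B : Set (α ⊕ Fin k)) (range Sum.inr) := by
    rw [disjoint_left]; rintro _ ⟨x, -, rfl⟩ ⟨y, hy⟩; cases hy
  rw [rk_map_image _ Sum.inl_injective, rk_delete _ hd]
  exact ((N.majorAux hN k le_rfl).2.2.2.2 B).symm

/-- Contracting the new elements in the major gives the last matroid of the factorization. -/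
theorem major_contract (N : FlagMatroid α k) (hN : N.IsElementary) :
    (N.major hN).contract (range Sum.inr) =
      (N.matroid (Fin.last k)).map Sum.inl Sum.inl_injective.injOn := by
  have hf : (N.major hN).Finite := (N.majorAux hN k le_rfl).2.1
  have hrk : ∀ A, rk (N.major hN) (Sum.inl '' A ∪ range Sum.inr) =
      rk (N.matroid (Fin.last k)) A + k := by
    intro A
    have := (N.majorAux hN k le_rfl).2.2.2.1 A
    rw [← image_univ, ← labels_self]
    exact this
  have h0 : rk (N.major hN) (range Sum.inr) = k := by
    have := hrk ∅
    rw [image_empty, empty_union] at this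
    rw [this]
    simp [rk]
  have hC : (N.major hN).Indep (range Sum.inr) := by
    rw [Matroid.indep_iff_eRk_eq_encard_of_finite (finite_range _), ← coe_rk, h0, ← image_univ,
      Sum.inr_injective.encard_image, encard_univ]
    simp
  have hE : ((N.matroid (Fin.last k)).map (Sum.inl : α → α ⊕ Fin k) Sum.inl_injective.injOn).E =
      ((N.major hN).contract (range Sum.inr)).E := by
    rw [Matroid.map_ground, Matroid.contract_ground, major_ground, N.ground_eq]
    ext (x | x) <;> simp
  refine (Matroid.ext_indep hE fun I hI => ?_).symm
  have hIf := Matroid.ground_finite _ |>.subset hI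
  rw [Matroid.map_ground] at hI
  obtain ⟨B, -, rfl⟩ := subset_image_iff.1 hI
  have hd : Disjoint (Sum.inl '' B : Set (α ⊕ Fin k)) (range Sum.inr) := by
    rw [disjoint_left]; rintro _ ⟨x, -, rfl⟩ ⟨y, hy⟩; cases hy
  rw [hC.contract_indep_iff, Matroid.indep_iff_eRk_eq_encard_of_finite hIf,
    Matroid.indep_iff_eRk_eq_encard_of_finite (hIf.union (finite_range _)), ← coe_rk, ← coe_rk,
    rk_map_image _ Sum.inl_injective, hrk, encard_union_eq hd, ← image_univ,
    Sum.inr_injective.encard_image univ, encard_univ]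
  simp [hd]

/-- The Higgs major of a flag matroid: the major of its Higgs factorization. -/
noncomputable def higgsMajor {l : ℕ} (F : FlagMatroid α l) : Matroid (α ⊕ Fin F.nullity) :=
  F.higgsFactorization.major F.higgsFactorization_isElementary

end FlagMatroid

/-! ### Realizability -/

/-- The map `φ` realizes the matroid `M` over `K`: it takes values in a `K`-vector space of
dimension `rank M`, and a set of elements of `M` is independent if and only if the corresponding
family of vectors is linearly independent. -/
structure IsRealization (K : Type u) [Field K] {V : Type u} [AddCommGroup V] [Module K V]
    {α : Type v} (M : Matroid α) (φ : α → V) : Prop where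
  finite : Module.Finite K V
  finrank_eq : Module.finrank K V = rank M
  indep_iff : ∀ A ⊆ M.E, M.Indep A ↔ LinearIndepOn K φ A

/-- A matroid is realizable over `K` if some map realizes it. -/
def IsRealizable (K : Type u) [Field K] {α : Type v} (M : Matroid α) : Prop :=
  ∃ (V : Type u) (_ : AddCommGroup V) (_ : Module K V) (φ : α → V), IsRealization K M φ

/-- A diagram of matroids: a family of matroids and, between any two of them, a set of morphisms. -/
structure MatroidDiagram (Λ : Type w) (α : Λ → Type v) where
  obj : (i : Λ) → Matroid (α i)
  hom : (i j : Λ) → Set (α i → α j)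
  isMorphism : ∀ i j, ∀ f ∈ hom i j, IsMorphism (obj i) (obj j) f

/-- A diagram of matroids is realizable over `K` if there are realizations of all its matroids
such that every morphism of the diagram is induced by a linear map. -/
def MatroidDiagram.IsRealizable (K : Type u) [Field K] {Λ : Type w} {α : Λ → Type v}
    (D : MatroidDiagram Λ α) : Prop :=
  ∃ (V : Λ → Type u) (_ : ∀ i, AddCommGroup (V i)) (_ : ∀ i, Module K (V i))
    (φ : (i : Λ) → α i → V i), (∀ i, IsRealization K (D.obj i) (φ i)) ∧
      ∀ i j, ∀ f ∈ D.hom i j, ∃ g : V i →ₗ[K] V j, ∀ e ∈ (D.obj i).E, g (φ i e) = φ j (f e)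

namespace FlagMatroid

/-- A flag matroid as a diagram of matroids, whose morphisms are its successive quotient maps
(the identity maps of the ground set). -/
def diagram {α : Type v} {l : ℕ} (F : FlagMatroid α l) :
    MatroidDiagram (Fin (l + 1)) fun _ => α where
  obj := F.matroid
  hom i j := {f | f = id ∧ i.1 + 1 = j.1}
  isMorphism := by
    rintro i j f ⟨rfl, hij⟩
    have hi : i.1 < l := by omega
    have := (F.isQuotient ⟨i.1, hi⟩).2
    rwa [show (⟨i.1, hi⟩ : Fin l).castSucc = i from rfl,
      show (⟨i.1, hi⟩ : Fin l).succ = j from Fin.ext hij] at this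

/-- A flag matroid (for example a factorization) is realizable over `K` if it is so as a diagram of
matroids. -/
def IsRealizable (K : Type u) [Field K] {α : Type v} {l : ℕ} (F : FlagMatroid α l) : Prop :=
  F.diagram.IsRealizable K

end FlagMatroid

end HiggsMajor

open Set Module Submodule

namespace HiggsMajor

universe u v w

/-! ### Linear algebra -/

section LinearAlgebra

variable {K : Type u} [Field K] {V : Type v} [AddCommGroup V] [Module K V]

/-! The cycle is flag to major to factorization to flag; only the first implication needs `K`
infinite.

From the flag to the major, everything takes place in the space `V₀` realizing `M₀`. The composite
linear maps from `V₀` to the spaces `Vᵢ` have nested kernels `κᵢ`, of dimension the nullity `nᵢ` of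
`M₀ ↠ Mᵢ`, and `dim (⟨φ₀ A⟩ + κᵢ) = rk Mᵢ A + nᵢ`. The new element with index `t`, where `nⱼ ≤ t <
nⱼ₊₁`, is sent to a vector `v t` generic in `κⱼ₊₁`: it lies in the span of a set of elements of `E`
and earlier new elements only if that span contains all of `κⱼ₊₁`. Such a vector exists because a
space over an infinite field is not a finite union of proper subspaces (`exists_generic_sequence`).
Adding generic vectors of `κⱼ₊₁` to `⟨φ₀ A⟩` raises the dimension by one at each step until `κⱼ₊₁`
is absorbed. This is the minimum in the rank formula `rk N_t A + t = min (rk Mⱼ A + t) (rk Mⱼ₊₁ A +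
nⱼ₊₁)` of the Higgs lift, so the contractions of the vector configuration by the first `t` new
vectors are the terms `N_t`.

These contractions alone do not determine the major. What remains is that a span containing a new
vector, and generated by earlier elements, contains all earlier new vectors. This follows from
genericity and the nesting of the kernels, and it matches the form `G ∪ {e₁, …, eᵢ}` of the members
of the modular cut. `rk_majorAux_eq` turns the two facts into a realization of the major.

From the major to the factorization, `N_i` is realized in the quotient of the ambient space by the
span of the first `i` new vectors, with the natural projections as linear maps
(`isRealizable_of_major`). From the factorization to the flag, it suffices to keep the terms `N_{nᵢ}
= Mᵢ` and to compose the linear maps between them. -/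

theorem finrank_span_insert_of_notMem [Module.Finite K V] {w : V} {S : Set V}
    (hw : w ∉ span K S) : finrank K (span K (insert w S)) = finrank K (span K S) + 1 := by
  rw [span_insert, sup_comm]
  exact finrank_sup_span_singleton hw

/-- Rank-nullity for `f` restricted to `P ⊔ ker f`, which has the same image as `P` and contains the
whole kernel. It converts ranks in a quotient space into dimensions of sums in the original space.
-/
theorem finrank_map_add_finrank_ker [Module.Finite K V] {W : Type w} [AddCommGroup W] [Module K W]
    (f : V →ₗ[K] W) (P : Submodule K V) :
    finrank K (P.map f) + finrank K (LinearMap.ker f) = finrank K ↥(P ⊔ LinearMap.ker f) := by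
  have h := (f.domRestrict (P ⊔ LinearMap.ker f)).finrank_range_add_finrank_ker
  rw [LinearMap.range_domRestrict, LinearMap.ker_domRestrict,
    (comapSubtypeEquivOfLe (le_sup_right : LinearMap.ker f ≤ P ⊔ LinearMap.ker f)).finrank_eq,
    Submodule.map_sup, (LinearMap.le_ker_iff_map.1 le_rfl : Submodule.map f (LinearMap.ker f) = ⊥),
    sup_bot_eq] at h
  exact h

/-- Over an infinite field, a subspace has a vector which lies in a member of a given finite family
of subspaces only if that member contains the whole subspace. -/
theorem exists_mem_forall_mem_imp_le [Infinite K] (U : Submodule K V)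
    {𝓟 : Set (Submodule K V)} (h𝓟 : 𝓟.Finite) : ∃ x ∈ U, ∀ P ∈ 𝓟, x ∈ P → U ≤ P := by
  classical
  -- Members of `𝓟` containing `U` become `⊤` inside `U` and are discarded. The others give finitely
  -- many proper subspaces of `U`, which cannot cover it.
  have hfin : ((fun P => comap U.subtype P) '' 𝓟 \ {⊤}).Finite := (h𝓟.image _).sdiff
  have htop : (⊤ : Submodule K U) ∉ hfin.toFinset := by simp
  obtain ⟨x, hx⟩ := (ne_univ_iff_exists_notMem _).1 (Subspace.biUnion_ne_univ_of_top_notMem htop)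
  refine ⟨x, x.2, fun P hP hxP => ?_⟩
  by_contra hUP
  refine hx (mem_iUnion₂.2 ⟨comap U.subtype P, ?_, hxP⟩)
  rw [Set.Finite.mem_toFinset]
  exact ⟨mem_image_of_mem _ hP, fun hc => hUP (comap_subtype_eq_top.1 hc)⟩

/-- A sequence of vectors, each in a prescribed subspace and generic there with respect to the spans
of the given vectors and the previous ones. -/
theorem exists_generic_sequence [Infinite K] {α : Type w} {E : Set α} (hE : E.Finite) (φ : α → V)
    {k : ℕ} (U : Fin k → Submodule K V) :
    ∃ v : Fin k → V, ∀ t, v t ∈ U t ∧ ∀ Y ⊆ Sum.inl '' E ∪ Sum.inr '' FlagMatroid.labels k t,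
      v t ∈ span K (Sum.elim φ v '' Y) → U t ≤ span K (Sum.elim φ v '' Y) := by
  -- Only the values of `v` below `m` are constrained; the others are placeholders. The condition at
  -- `t` involves only `v t` and earlier vectors, so it survives when later values are overwritten.
  suffices H : ∀ m ≤ k, ∃ v : Fin k → V, ∀ t : Fin k, t.1 < m → v t ∈ U t ∧
      ∀ Y ⊆ Sum.inl '' E ∪ Sum.inr '' FlagMatroid.labels k t,
        v t ∈ span K (Sum.elim φ v '' Y) → U t ≤ span K (Sum.elim φ v '' Y) by
    obtain ⟨v, hv⟩ := H k le_rfl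
    exact ⟨v, fun t => hv t t.2⟩
  intro m
  induction m with
  | zero => exact fun _ => ⟨0, fun t ht => absurd ht (Nat.not_lt_zero _)⟩
  | succ m ih =>
    intro hm
    obtain ⟨v, hv⟩ := ih (Nat.le_of_succ_le hm)
    -- The ground set and the earlier labels are finite, so the next vector has only finitely many
    -- spans to avoid.
    have hfin : ((fun Y => span K (Sum.elim φ v '' Y)) ''
        𝒫 (Sum.inl '' E ∪ Sum.inr '' FlagMatroid.labels k m)).Finite :=
      (((hE.image _).union (toFinite _)).finite_subsets).image _
    obtain ⟨x, hxU, hx⟩ := exists_mem_forall_mem_imp_le (U ⟨m, hm⟩) hfin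
    have hcongr : ∀ t : ℕ, t ≤ m → ∀ Y ⊆ Sum.inl '' E ∪ Sum.inr '' FlagMatroid.labels k t,
        Sum.elim φ (Function.update v ⟨m, hm⟩ x) '' Y = Sum.elim φ v '' Y := by
      intro t ht Y hY
      refine image_congr fun y hy => ?_
      rcases hY hy with ⟨a, -, rfl⟩ | ⟨s, hs, rfl⟩
      · rfl
      · have hs' : s.1 < t := hs
        exact Function.update_of_ne (fun hc => by rw [hc] at hs'; exact absurd ht hs'.not_ge) _ _
    refine ⟨Function.update v ⟨m, hm⟩ x, fun t ht => ?_⟩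
    rcases Nat.lt_succ_iff_lt_or_eq.1 ht with ht | ht
    · rw [Function.update_of_ne (fun hc => by rw [hc] at ht; exact lt_irrefl _ ht)]
      refine ⟨(hv t ht).1, fun Y hY => ?_⟩
      rw [hcongr t ht.le Y hY]
      exact (hv t ht).2 Y hY
    · obtain rfl : t = ⟨m, hm⟩ := Fin.ext ht
      rw [Function.update_self]
      refine ⟨hxU, fun Y hY => ?_⟩
      rw [hcongr m le_rfl Y hY]
      exact hx _ (mem_image_of_mem _ hY)

end LinearAlgebra

/-! ### Realizations and ranks -/

section Realization

variable {K : Type u} [Field K] {V : Type u} [AddCommGroup V] [Module K V] {α : Type v}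
  {M : Matroid α} {φ : α → V}

/-- A basis of `A` is sent to a linearly independent family, and by maximality this family spans `φ
'' A`. With its converse `IsRealization.of_rk_eq`, it reduces all questions about realizations to
dimension counts. -/
theorem IsRealization.rk_eq [M.Finite] (h : IsRealization K M φ) {A : Set α} (hA : A ⊆ M.E) :
    rk M A = finrank K (span K (φ '' A)) := by
  obtain ⟨I, hI⟩ := M.exists_isBasis A
  have hli := (h.indep_iff I (hI.subset.trans hA)).1 hI.indep
  have hIf : I.Finite := M.ground_finite.subset (hI.subset.trans hA)
  have hspan : span K (φ '' I) = span K (φ '' A) := by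
    refine le_antisymm (span_mono (image_mono hI.subset)) (span_le.2 ?_)
    rintro _ ⟨a, ha, rfl⟩
    by_cases haI : a ∈ I
    · exact subset_span (mem_image_of_mem _ haI)
    by_contra hc
    have h1 := (linearIndepOn_insert haI).2 ⟨hli, hc⟩
    rw [← h.indep_iff _ (insert_subset (hA ha) (hI.subset.trans hA))] at h1
    exact haI (hI.mem_of_insert_indep ha h1)
  have := hIf.fintype
  have hcard := linearIndependent_iff_card_eq_finrank_span.1 hli.linearIndependent
  rw [show range (fun i : I => φ i) = φ '' I from (image_eq_range φ I).symm, Set.finrank,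
    hspan] at hcard
  rw [← hcard, rk, ← hI.encard_eq_eRk, ← ncard_def, ncard_eq_toFinset_card', toFinset_card]

theorem IsRealization.of_rk_eq [M.Finite] [Module.Finite K V] (hr : finrank K V = rank M)
    (h : ∀ A ⊆ M.E, rk M A = finrank K (span K (φ '' A))) : IsRealization K M φ := by
  refine ⟨inferInstance, hr, fun A hA => ?_⟩
  have hAf := M.ground_finite.subset hA
  have := hAf.fintype
  rw [Matroid.indep_iff_eRk_eq_encard_of_finite hAf, ← coe_rk, LinearIndepOn,
    linearIndependent_iff_card_eq_finrank_span,
    show range (fun i : A => φ i) = φ '' A from (image_eq_range φ A).symm, Set.finrank, ← h A hA,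
    encard_eq_coe_toFinset_card, toFinset_card, Nat.cast_inj, eq_comm]

/-- The dimension of the space is required to equal the rank, so nothing is left outside the span.
Hence a linear map is determined by its values on the elements of the matroid. -/
theorem IsRealization.span_eq_top [M.Finite] (h : IsRealization K M φ) :
    span K (φ '' M.E) = ⊤ := by
  have := h.finite
  exact eq_top_of_finrank_eq ((h.rk_eq subset_rfl).symm.trans h.finrank_eq.symm)

end Realization

namespace FlagMatroid

variable {K : Type u} [Field K] {α : Type v}

/-- Asking for maps between all pairs `i ≤ j` is convenient, since kept terms of a longer chain need
not be consecutive there. -/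
theorem isRealizable_of_linearMaps {l : ℕ} {F : FlagMatroid α l} (V : Fin (l + 1) → Type u)
    [∀ i, AddCommGroup (V i)] [∀ i, Module K (V i)] {φ : ∀ i, α → V i}
    (hφ : ∀ i, IsRealization K (F.matroid i) (φ i))
    (hg : ∀ i j, i ≤ j → ∃ g : V i →ₗ[K] V j, ∀ e ∈ (F.matroid 0).E, g (φ i e) = φ j e) :
    F.IsRealizable K := by
  refine ⟨V, inferInstance, inferInstance, φ, hφ, ?_⟩
  rintro i j f ⟨rfl, hij⟩
  obtain ⟨g, hg⟩ := hg i j (Fin.le_def.2 (by omega))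
  exact ⟨g, fun e he => hg e (F.ground_eq i ▸ he)⟩

/-- In a realization of a flag matroid, all quotient maps of the flag are induced by linear maps. -/
theorem exists_linearMap_of_le {l : ℕ} {F : FlagMatroid α l} {V : Fin (l + 1) → Type u}
    [∀ i, AddCommGroup (V i)] [∀ i, Module K (V i)] {φ : ∀ i, α → V i}
    (hg : ∀ i j, ∀ f ∈ F.diagram.hom i j, ∃ g : V i →ₗ[K] V j,
      ∀ e ∈ (F.diagram.obj i).E, g (φ i e) = φ j (f e)) {i j : Fin (l + 1)} (hij : i ≤ j) :
    ∃ g : V i →ₗ[K] V j, ∀ e ∈ (F.matroid 0).E, g (φ i e) = φ j e := by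
  induction j using Fin.induction with
  | zero => rw [Fin.le_zero_iff.1 hij]; exact ⟨LinearMap.id, fun _ _ => rfl⟩
  | succ j ih =>
    rcases hij.lt_or_eq with h | rfl
    · obtain ⟨g, hg1⟩ := ih (Fin.le_castSucc_iff.2 h)
      obtain ⟨g', hg2⟩ := hg j.castSucc j.succ id ⟨rfl, rfl⟩
      refine ⟨g' ∘ₗ g, fun e he => ?_⟩
      rw [LinearMap.comp_apply, hg1 e he]
      exact hg2 e ((F.ground_eq j.castSucc).symm ▸ he)
    · exact ⟨LinearMap.id, fun _ _ => rfl⟩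

/-! ### From the factorization to the flag -/

/-- The `i`-th matroid of the flag is the term of the factorization with index `nullityTo i`. A
realization of the whole chain therefore restricts to one of the flag. -/
theorem isRealizable_of_higgsFactorization {l : ℕ} {F : FlagMatroid α l}
    (h : F.higgsFactorization.IsRealizable K) : F.IsRealizable K := by
  obtain ⟨V, _, _, φ, hφ, hg⟩ := h
  let n : Fin (l + 1) → Fin (F.nullity + 1) := fun i =>
    ⟨F.nullityTo i, Nat.lt_succ_of_le (F.nullityTo_mono (Fin.le_last i))⟩
  refine isRealizable_of_linearMaps (fun i => V (n i)) (φ := fun i => φ (n i)) (fun i => ?_)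
    fun i j hij => ?_
  · have := hφ (n i)
    rwa [show F.higgsFactorization.diagram.obj (n i) = F.matroid i from
      F.higgsTerm_nullityTo i] at this
  · obtain ⟨g, hg⟩ := exists_linearMap_of_le hg (i := n i) (j := n j)
      (Fin.le_def.2 (F.nullityTo_mono hij))
    exact ⟨g, fun e he => hg e ((F.higgsTerm_ground _).symm ▸ he)⟩

/-! ### From the major to the factorization -/

variable {k : ℕ} (N : FlagMatroid α k) (hN : N.IsElementary)

theorem IsElementary.rank_add {N : FlagMatroid α k} (hN : N.IsElementary) (i : Fin (k + 1)) :
    rank (N.matroid i) + i = rank (N.matroid 0) := by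
  induction i using Fin.induction with
  | zero => rfl
  | succ i ih =>
    have := hN i
    rw [Fin.val_succ]
    rw [Fin.val_castSucc] at ih
    omega

theorem labels_mono {i j : ℕ} (h : i ≤ j) : labels k i ⊆ labels k j :=
  fun _ hx => lt_of_lt_of_le hx h

theorem labels_zero : labels k 0 = ∅ := by
  simp [labels]

theorem labels_succ {i : ℕ} (hi : i < k) :
    labels k (i + 1) = insert ⟨i, hi⟩ (labels k i) := by
  ext x
  simp only [labels, mem_ofPred_eq, mem_insert_iff, Fin.ext_iff]
  omega

/-- The recursive step of the major in terms of ranks, freed from the properties bundled with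
`majorAux`. -/
theorem rk_majorAux_succ {i : ℕ} (hi : i < k) (X : Set (α ⊕ Fin k)) :
    rk (N.majorAux hN (i + 1) hi).1 X = extensionRank (N.majorAux hN i hi.le).1
      ((fun G => Sum.inl '' G ∪ Sum.inr '' labels k i) ''
        elementaryCut (N.matroid (⟨i, hi⟩ : Fin k).castSucc) (N.matroid (⟨i, hi⟩ : Fin k).succ))
      (Sum.inr ⟨i, hi⟩) X := by
  have H := (N.majorAux hN i hi.le).2
  have : (N.majorAux hN i hi.le).1.Finite := H.1
  exact rk_extension (isModularCut_lift (N.isQuotient ⟨i, hi⟩) (hN ⟨i, hi⟩) H.2.1 H.2.2.1)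
    (by rw [H.2.1]; simp [labels]) X

/-- Contracting the first `i` new elements of the major of a factorization (and deleting the others)
gives the `i`-th matroid of the factorization. -/
theorem rk_majorAux_labels (m : ℕ) (hm : m ≤ k) (i : ℕ) (hi : i ≤ m) (A : Set α) :
    rk (N.majorAux hN m hm).1 (Sum.inl '' A ∪ Sum.inr '' labels k i) =
      rk (N.matroid ⟨i, Nat.lt_succ_of_le (hi.trans hm)⟩) A + i := by
  induction m with
  | zero =>
    obtain rfl := Nat.le_zero.1 hi
    exact (N.majorAux hN 0 hm).2.2.2.1 A
  | succ m ih =>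
    rcases hi.eq_or_lt with rfl | hi
    · exact (N.majorAux hN (m + 1) hm).2.2.2.1 A
    · rw [← ih (Nat.le_of_succ_le hm) (Nat.le_of_lt_succ hi)]
      -- For `i ≤ m` the element added last is not in the set, so the rank is already that in the
      -- previous matroid.
      rw [N.rk_majorAux_succ hN hm, extensionRank_of_notMem]
      simpa [labels] using Nat.le_of_lt_succ hi

instance : (N.major hN).Finite := (N.majorAux hN k le_rfl).2.1

/-- The new elements raise the ground set but not the rank: contracting all `k` of them leaves
`N_k`, and `rank N_k + k = rank N₀`. -/
theorem rank_major : rank (N.major hN) = rank (N.matroid 0) := by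
  rw [rank, major_ground, ← image_univ, ← labels_self]
  refine (N.rk_majorAux_labels hN k le_rfl k le_rfl _).trans ?_
  rw [← N.rank_eq]
  exact hN.rank_add ⟨k, _⟩

/-- Contraction is realized by passing to a quotient space: contracting the first `i` new elements
corresponds to dividing by their span `U i`, and the inclusions `U i ≤ U j` provide the linear maps.
-/
theorem isRealizable_of_major (h : HiggsMajor.IsRealizable K (N.major hN)) :
    N.IsRealizable K := by
  obtain ⟨W, _, _, ψ, hψ⟩ := h
  have := hψ.finite
  let U : Fin (k + 1) → Submodule K W := fun i => span K (ψ '' (Sum.inr '' labels k i))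
  have hsub : ∀ A ⊆ (N.matroid 0).E, ∀ i, Sum.inl '' A ∪ Sum.inr '' labels k i ⊆ (N.major hN).E :=
    fun A hA i => by
      rw [major_ground]
      exact union_subset_union (image_mono hA) (image_subset_range _ _)
  have hrk : ∀ A ⊆ (N.matroid 0).E, ∀ i : Fin (k + 1),
      finrank K ↥(span K (ψ '' (Sum.inl '' A)) ⊔ U i) = rk (N.matroid i) A + i := fun A hA i => by
    rw [← span_union, ← image_union, ← hψ.rk_eq (hsub A hA i)]
    exact N.rk_majorAux_labels hN k le_rfl i (Nat.le_of_lt_succ i.2) A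
  -- The case `A = ∅` of the contraction formula: the new vectors are linearly independent.
  have hU : ∀ i, finrank K (U i) = i := fun i => by
    have := hrk ∅ (empty_subset _) i
    rwa [image_empty, image_empty, span_empty, bot_sup_eq,
      show rk (N.matroid i) ∅ = 0 by simp [rk], zero_add] at this
  refine isRealizable_of_linearMaps (fun i => W ⧸ U i)
    (φ := fun i a => (U i).mkQ (ψ (Sum.inl a))) (fun i => ?_) fun i j hij => ?_
  · refine IsRealization.of_rk_eq ?_ fun A hA => ?_
    · have h1 := finrank_quotient_add_finrank (U i)
      have h2 := hN.rank_add i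
      have h3 := hψ.finrank_eq
      rw [rank_major] at h3
      have h4 := hU i
      omega
    · have h1 := finrank_map_add_finrank_ker (U i).mkQ (span K (ψ '' (Sum.inl '' A)))
      rw [ker_mkQ, hrk A (N.ground_eq i ▸ hA) i, hU i, map_span, image_image, image_image] at h1
      omega
  · exact ⟨Submodule.mapQ _ _ LinearMap.id
      (span_mono (image_mono (image_mono (labels_mono (Fin.le_def.1 hij))))), fun e _ => rfl⟩

/-! ### From the flag to the major -/

/-- Recognizing a realization of the major of a factorization. -/
theorem rk_majorAux_eq {W : Type u} [AddCommGroup W] [Module K W] [Module.Finite K W]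
    {ψ : α ⊕ Fin k → W}
    (hrk : ∀ i : Fin (k + 1), ∀ A ⊆ (N.matroid 0).E,
      finrank K (span K (ψ '' (Sum.inl '' A ∪ Sum.inr '' labels k i))) = rk (N.matroid i) A + i)
    (hgen : ∀ i : Fin k, ∀ Y ⊆ Sum.inl '' (N.matroid 0).E ∪ Sum.inr '' labels k i,
      ψ (Sum.inr i) ∈ span K (ψ '' Y) → ∀ s < i, ψ (Sum.inr s) ∈ span K (ψ '' Y))
    (i : ℕ) (hi : i ≤ k) : ∀ X ⊆ Sum.inl '' (N.matroid 0).E ∪ Sum.inr '' labels k i,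
      rk (N.majorAux hN i hi).1 X = finrank K (span K (ψ '' X)) := by
  induction i with
  | zero =>
    intro X hX
    have h0 : (Sum.inr '' labels k 0 : Set (α ⊕ Fin k)) = ∅ := by rw [labels_zero, image_empty]
    rw [h0, union_empty] at hX
    obtain ⟨A, hA, rfl⟩ := subset_image_iff.1 hX
    have h1 := hrk 0 A hA
    rw [show ((0 : Fin (k + 1)) : ℕ) = 0 from rfl, h0, union_empty] at h1
    rw [h1]
    exact (N.majorAux hN 0 hi).2.2.2.2 A
  | succ i ih =>
    intro X hX
    have hi' := Nat.le_of_succ_le hi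
    let H := (N.majorAux hN i hi').1
    have hHf : H.Finite := (N.majorAux hN i hi').2.1
    let e : α ⊕ Fin k := Sum.inr ⟨i, hi⟩
    let 𝓜 : Set (Set (α ⊕ Fin k)) := (fun G => Sum.inl '' G ∪ Sum.inr '' labels k i) ''
        elementaryCut (N.matroid (⟨i, hi⟩ : Fin k).castSucc) (N.matroid (⟨i, hi⟩ : Fin k).succ)
    have hHE : H.E = Sum.inl '' (N.matroid 0).E ∪ Sum.inr '' labels k i := by
      rw [← N.ground_eq ⟨i, Nat.lt_succ_of_le hi'⟩]
      exact (N.majorAux hN i hi').2.2.1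
    have he : e ∉ H.E := by rw [hHE]; simp [e, labels]
    have hext : ∀ X, rk (N.majorAux hN (i + 1) hi).1 X = extensionRank H 𝓜 e X :=
      N.rk_majorAux_succ hN hi
    specialize ih hi'
    rw [← hHE] at ih
    change ∀ X ⊆ H.E, rk H X = _ at ih
    -- By induction `ψ` represents `H`, so closure in `H` is membership in the linear span.
    have hmem : ∀ Y ⊆ H.E, ∀ x ∈ H.E, x ∈ H.closure Y ↔ ψ x ∈ span K (ψ '' Y) := by
      intro Y hY x hx
      rw [mem_closure_iff_rk H hx, ih Y hY, ih _ (insert_subset hx hY), image_insert_eq]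
      constructor
      · intro h
        by_contra hc
        rw [finrank_span_insert_of_notMem hc] at h
        omega
      · exact fun h => by rw [span_insert_eq_span h]
    -- For sets containing all earlier new elements, `hrk` and the contraction formula give the same
    -- rank after `e` is added, and the induction hypothesis gives the same rank before. The rank is
    -- unchanged in the extension exactly when the closure is in the cut, and in `W` exactly when `ψ
    -- e` is in the span.
    have hfull : ∀ G : Set α, Sum.inl '' G ∪ Sum.inr '' labels k i ⊆ H.E →
        (H.closure (Sum.inl '' G ∪ Sum.inr '' labels k i) ∈ 𝓜 ↔
          ψ e ∈ span K (ψ '' (Sum.inl '' G ∪ Sum.inr '' labels k i))) := by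
      intro G hG
      have hG0 : G ⊆ (N.matroid 0).E := fun x hx => by
        simpa [hHE] using hG (Or.inl (mem_image_of_mem _ hx))
      have heG : e ∉ Sum.inl '' G ∪ Sum.inr '' labels k i := fun hc => he (hG hc)
      have h1 := N.rk_majorAux_labels hN (i + 1) hi (i + 1) le_rfl G
      rw [← hrk ⟨i + 1, Nat.lt_succ_of_le hi⟩ G hG0, hext, labels_succ hi, image_insert_eq,
        union_insert, image_insert_eq] at h1
      have h2 := ih _ hG
      by_cases hcl : H.closure (Sum.inl '' G ∪ Sum.inr '' labels k i) ∈ 𝓜 <;>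
        by_cases hψ : ψ e ∈ span K (ψ '' (Sum.inl '' G ∪ Sum.inr '' labels k i))
      · exact iff_of_true hcl hψ
      · rw [extensionRank_insert heG hcl, finrank_span_insert_of_notMem hψ] at h1
        omega
      · rw [extensionRank_insert' heG hcl, span_insert_eq_span hψ] at h1
        omega
      · exact iff_of_false hcl hψ
    -- General `Y` reduces to `hfull` once its closure is known to contain all earlier new elements.
    -- If the closure is in the cut, this is the shape of the members of `𝓜`; if `ψ e` lies in the
    -- span, it is the hypothesis `hgen`.
    have hcut : ∀ Y ⊆ H.E, (H.closure Y ∈ 𝓜 ↔ ψ e ∈ span K (ψ '' Y)) := by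
      intro Y hY
      have hspan : span K (ψ '' H.closure Y) = span K (ψ '' Y) := by
        refine le_antisymm (span_le.2 ?_) (span_mono (image_mono (H.subset_closure Y hY)))
        rintro _ ⟨x, hx, rfl⟩
        exact (hmem Y hY x (Matroid.mem_ground_of_mem_closure hx)).1 hx
      have hclY := H.closure_subset_ground Y
      have key : ∀ G : Set α, Sum.inl '' G ∪ Sum.inr '' labels k i = H.closure Y →
          (H.closure Y ∈ 𝓜 ↔ ψ e ∈ span K (ψ '' Y)) := by
        intro G hG
        have := hfull G (hG ▸ hclY)
        rwa [hG, Matroid.closure_closure, hspan] at this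
      constructor
      · intro h
        obtain ⟨G, -, hG⟩ := id h
        exact (key G hG).1 h
      · intro h
        refine (key (Sum.inl ⁻¹' H.closure Y) ?_).2 h
        ext (x | s)
        · simp
        · have h1 : s ∈ labels k i ↔ Sum.inr s ∈ H.E := by simp [hHE]
          have h2 : Sum.inr s ∈ H.closure Y → Sum.inr s ∈ H.E := fun h => hclY h
          have h3 : s ∈ labels k i → Sum.inr s ∈ H.closure Y := fun hs =>
            (hmem Y hY _ (h1.1 hs)).2 (hgen ⟨i, hi⟩ Y (hHE ▸ hY) h s hs)
          simp
          tauto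
    have hXe : ∀ x ∈ X, x ≠ e → x ∈ H.E := by
      intro x hx hxe
      have := hX hx
      rw [labels_succ hi, image_insert_eq, union_insert] at this
      rw [hHE]
      exact this.resolve_left hxe
    rw [hext]
    by_cases heX : e ∈ X
    · obtain ⟨Y, heY, rfl⟩ : ∃ Y, e ∉ Y ∧ X = insert e Y :=
        ⟨X \ {e}, by simp, by rw [insert_sdiff_singleton, insert_eq_of_mem heX]⟩
      have hY : Y ⊆ H.E := fun y hy =>
        hXe y (mem_insert_of_mem _ hy) fun hc => heY (hc ▸ hy)
      rw [image_insert_eq]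
      by_cases hψ : ψ e ∈ span K (ψ '' Y)
      · rw [extensionRank_insert heY ((hcut Y hY).2 hψ), span_insert_eq_span hψ, ih Y hY]
      · rw [extensionRank_insert' heY (fun hc => hψ ((hcut Y hY).1 hc)),
          finrank_span_insert_of_notMem hψ, ih Y hY]
    · rw [extensionRank_of_notMem heX]
      exact ih X fun x hx => hXe x hx fun hc => heX (hc ▸ hx)

/-- The rank of the major is that of `M₀`, so the realization stays in `V 0`; the new elements are
sent to generic vectors of the kernels. -/
theorem higgsMajor_isRealizable [Infinite K] {l : ℕ} {F : FlagMatroid α l}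
    (h : F.IsRealizable K) : HiggsMajor.IsRealizable K F.higgsMajor := by
  obtain ⟨V, _, _, φ, hφ, hg⟩ := h
  change ∀ i, IsRealization K (F.matroid i) (φ i) at hφ
  have := fun i => (hφ i).finite
  choose g hg using fun i j => fun (hij : i ≤ j) => exists_linearMap_of_le hg hij
  let κ : Fin (l + 1) → Submodule K (V 0) := fun i => LinearMap.ker (g 0 i (Fin.zero_le i))
  have hmap : ∀ i, ∀ A ⊆ (F.matroid 0).E,
      Submodule.map (g 0 i (Fin.zero_le i)) (span K (φ 0 '' A)) = span K (φ i '' A) := by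
    intro i A hA
    rw [map_span, image_image]
    exact congrArg _ (image_congr fun a ha => hg 0 i _ a (hA ha))
  have hκmono : ∀ i j, i ≤ j → κ i ≤ κ j := by
    intro i j hij
    -- The maps `g` were chosen independently for each pair; they are compatible because they agree
    -- on `φ 0 '' E`, which spans `V 0`.
    have : g 0 j (Fin.zero_le j) = g i j hij ∘ₗ g 0 i (Fin.zero_le i) := by
      refine LinearMap.ext_on (hφ 0).span_eq_top ?_
      rintro _ ⟨a, ha, rfl⟩
      rw [LinearMap.comp_apply, hg 0 i _ a ha, hg i j _ a ha, hg 0 j _ a ha]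
    change LinearMap.ker _ ≤ LinearMap.ker _
    rw [this]
    exact LinearMap.ker_le_ker_comp _ _
  have hκsup : ∀ i, ∀ A ⊆ (F.matroid 0).E, finrank K ↥(span K (φ 0 '' A) ⊔ κ i) =
      rk (F.matroid i) A + F.nullityTo i := by
    have h1 : ∀ i, ∀ A ⊆ (F.matroid 0).E, rk (F.matroid i) A + finrank K (κ i) =
        finrank K ↥(span K (φ 0 '' A) ⊔ κ i) := by
      intro i A hA
      rw [← finrank_map_add_finrank_ker, hmap i A hA, (hφ i).rk_eq ((F.ground_eq i).symm ▸ hA)]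
    intro i A hA
    -- Taking `A = E` gives `dim (κ i) = nullityTo i`.
    have h2 := h1 i _ subset_rfl
    rw [(hφ 0).span_eq_top, top_sup_eq, finrank_top, (hφ 0).finrank_eq, ← F.rank_eq] at h2
    have h3 := F.nullityTo_add_rank i
    rw [← h1 i A hA]
    omega
  -- `b t` is the step of the flag whose Higgs factorization contains the quotient `N_t ↠ N_{t+1}`.
  choose b hb1 hb2 using fun t : Fin F.nullity => F.exists_step t.2
  obtain ⟨v, hv⟩ := exists_generic_sequence (F.matroid 0).ground_finite (φ 0)
    (fun t => κ (b t).succ)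
  let ψ : α ⊕ Fin F.nullity → V 0 := Sum.elim (φ 0) v
  -- Later labels belong to the same or a later step, hence to a larger kernel. So the kernel used
  -- for `t` contains all `v s` with `s ≤ t`.
  have hbmono : ∀ s t, s ≤ t → (b s).succ ≤ (b t).succ := by
    intro s t hst
    by_contra! hc
    have h1 := F.nullityTo_mono (show (b t).succ ≤ (b s).castSucc from
      Fin.le_castSucc_iff.2 hc)
    have h2 := hb2 t
    have h3 := hb1 s
    have h4 := Fin.le_def.1 hst
    omega
  have hvκ : ∀ s t, s ≤ t → v s ∈ κ (b t).succ := fun s t hst =>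
    hκmono _ _ (hbmono s t hst) (hv s).1
  have hgen : ∀ i : Fin F.nullity, ∀ Y ⊆ Sum.inl '' (F.matroid 0).E ∪
      Sum.inr '' labels F.nullity i, ψ (Sum.inr i) ∈ span K (ψ '' Y) →
        κ (b i).succ ≤ span K (ψ '' Y) := fun i => (hv i).2
  have hrk : ∀ i : ℕ, i ≤ F.nullity → ∀ A ⊆ (F.matroid 0).E,
      finrank K (span K (ψ '' (Sum.inl '' A ∪ Sum.inr '' labels F.nullity i))) =
        rk (F.higgsTerm i) A + i := by
    intro i
    induction i with
    | zero =>
      intro _ A hA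
      have h1 := F.higgsTerm_nullityTo 0
      rw [nullityTo, tsub_self] at h1
      rw [h1, (hφ 0).rk_eq hA, labels_zero, image_empty, union_empty, image_image]
      rfl
    | succ i ih =>
      intro hi A hA
      specialize ih (Nat.le_of_succ_le hi) A hA
      let t : Fin F.nullity := ⟨i, hi⟩
      have hb1 : F.nullityTo (b t).castSucc ≤ i := hb1 t
      have hb2 : i < F.nullityTo (b t).succ := hb2 t
      set Y : Set (α ⊕ Fin F.nullity) := Sum.inl '' A ∪ Sum.inr '' labels F.nullity i with hY
      -- This sum is the ceiling of the growth: its dimension is the second term of the minimum in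
      -- the rank formula, shifted by the number of new vectors.
      have hle : span K (ψ '' Y) ≤ span K (φ 0 '' A) ⊔ κ (b t).succ := by
        rw [hY, image_union, span_union, image_image]
        refine sup_le_sup le_rfl (span_le.2 ?_)
        rintro _ ⟨_, ⟨s, hs, rfl⟩, rfl⟩
        exact hvκ s t (le_of_lt hs)
      have hA' : span K (φ 0 '' A) ≤ span K (ψ '' Y) := by
        refine span_mono ?_
        rw [hY, image_union, image_image]
        exact subset_union_left
      have hsup := hκsup (b t).succ A hA
      have hfin := Submodule.finrank_mono hle
      rw [F.rk_higgsTerm (b t) hb1 hb2.le] at ih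
      -- The rank formula includes the right end `nullityTo (b t).succ`, so the same step `b t`
      -- computes both `N_i` and `N_{i+1}`.
      rw [labels_succ hi, image_insert_eq, union_insert, ← hY, image_insert_eq,
        F.rk_higgsTerm (b t) (by omega) hb2]
      by_cases hψ : ψ (Sum.inr t) ∈ span K (ψ '' Y)
      · have hκ := hgen t Y (union_subset_union_left _ (image_mono hA)) hψ
        have := Submodule.finrank_mono (sup_le hA' hκ)
        rw [span_insert_eq_span hψ]
        omega
      · have hlt : finrank K (span K (ψ '' Y)) <
            finrank K ↥(span K (φ 0 '' A) ⊔ κ (b t).succ) := by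
          refine Submodule.finrank_lt_finrank_of_lt (lt_of_le_not_ge hle fun hc => hψ ?_)
          exact hc (le_sup_right (a := span K (φ 0 '' A)) (hvκ t t le_rfl))
        rw [finrank_span_insert_of_notMem hψ]
        omega
  have h0 : F.higgsFactorization.matroid 0 = F.matroid 0 := by
    have h1 := F.higgsTerm_nullityTo 0
    rwa [nullityTo, tsub_self] at h1
  refine ⟨V 0, inferInstance, inferInstance, ψ, ?_⟩
  have : F.higgsMajor.Finite := (F.higgsFactorization.majorAux _ _ le_rfl).2.1
  refine IsRealization.of_rk_eq ?_ fun X hX => ?_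
  · rw [higgsMajor, rank_major, h0]
    exact (hφ 0).finrank_eq
  · refine F.higgsFactorization.rk_majorAux_eq F.higgsFactorization_isElementary
      (fun i A hA => ?_) (fun i Y hY hψ s hs => ?_) F.nullity le_rfl X ?_
    · exact hrk i (Nat.le_of_lt_succ i.2) A (h0 ▸ hA)
    · exact hgen i Y (h0 ▸ hY) hψ (hvκ s i hs.le)
    · rw [labels_self, image_univ]
      exact hX.trans (major_ground _ _).subset

end FlagMatroid

end HiggsMajor

theorem mainTheorem2 {K : Type*} [Field K] [Infinite K] {α : Type*} {l : ℕ}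
    (F : HiggsMajor.FlagMatroid α l) :
    List.TFAE [
      F.IsRealizable K,
      F.higgsFactorization.IsRealizable K,
      HiggsMajor.IsRealizable K F.higgsMajor] := by
  tfae_have 1 → 3 := HiggsMajor.FlagMatroid.higgsMajor_isRealizable
  tfae_have 3 → 2 := F.higgsFactorization.isRealizable_of_major F.higgsFactorization_isElementary
  tfae_have 2 → 1 := HiggsMajor.FlagMatroid.isRealizable_of_higgsFactorization
  tfae_finish
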